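/- Let $0<q<1$. For $x\in\mathbb{C}$ put $(x;q)_\infty=\prod_{i\ge 0}(1-xq^i)$ and $(x_1,\dots,x_r;q)_\infty=\prod_{j}(x_j;q)_\infty$; for $x\in\mathbb{C}\setminus\{0\}$ put $\theta(x)=(x,q/x;q)_\infty$ and $\theta(x_1,\dots,x_r)=\prod_j\theta(x_j)$. Let $a,b,c,u\in\mathbb{C}\setminus\{0\}$ satisfy $q<|u|<1$ and $|a|,|b|,|c|<1$, and let them be generic in the sense that none of $au,\ bu,\ cu,\ u^2$ is of the form $q^n$ with $n\in\mathbb{Z}$. Write $$F(x)=\frac{(x^2,1/x^2;q)_\infty}{(ax,a/x,bx,b/x,cx,c/x;q)_\infty\,\theta(ux,u/x)\,x}.$$ Then $F$ is integrable over the positively oriented unit circle $\mathbb{T}$, $F$ is meromorphic at each point $uq^{-k}$, $k\ge 1$, the series of residues below converges absolutely, and $$\frac{1}{4\pi i}\int_{\mathbb{T}}F(x)\,dx+\sum_{k=1}^\infty\operatorname*{Res}_{x=uq^{-k}}F(x)=\frac{1}{(q,ab,ac,bc;q)_\infty}\,\frac{\theta(abcu)}{\theta(au,bu,cu)}.$$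 -/

import Mathlib

open scoped Topology

/-- The infinite `q`-shifted factorial `(x; q)_∞ = ∏_{i ≥ 0} (1 - x q ^ i)`, for real `q`
(the product converges for `|q| < 1`). -/
noncomputable def qPoch (q : ℝ) (x : ℂ) : ℂ :=
  ∏' i : ℕ, (1 - x * (q : ℂ) ^ i)

/-- The product `(x₁, …, x_r; q)_∞` of infinite `q`-shifted factorials. -/
noncomputable def qPochs (q : ℝ) (l : List ℂ) : ℂ :=
  (l.map (qPoch q)).prod

/-- The renormalized Jacobi theta function `θ(x) = (x, q / x; q)_∞`, for `x ≠ 0`. -/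
noncomputable def qTheta (q : ℝ) (x : ℂ) : ℂ :=
  qPochs q [x, (q : ℂ) / x]

/-- The product `θ(x₁, …, x_r) = θ(x₁) ⋯ θ(x_r)`. -/
noncomputable def qThetas (q : ℝ) (l : List ℂ) : ℂ :=
  (l.map (qTheta q)).prod

/-- The residue at `z` of a function that is holomorphic in a punctured neighbourhood of `z`:
the common value of `(2πi)⁻¹ ∮ f` over all sufficiently small circles around `z`. -/
noncomputable def complexResidue (f : ℂ → ℂ) (z : ℂ) : ℂ :=
  Filter.limUnder (𝓝[>] (0 : ℝ))
    (fun r : ℝ => (2 * (Real.pi : ℂ) * Complex.I)⁻¹ * ∮ x in C(z, r), f x)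

/-- The function
`(x², 1/x²; q)_∞ / ((ax, a/x, bx, b/x, cx, c/x; q)_∞ θ(ux, u/x) x)` of `x`. -/
noncomputable def macdonaldMehtaIntegrand (q : ℝ) (a b c u x : ℂ) : ℂ :=
  qPochs q [x ^ 2, 1 / x ^ 2] /
    (qPochs q [a * x, a / x, b * x, b / x, c * x, c / x] * qThetas q [u * x, u / x] * x)

/-!
# A three-parameter `q`-beta integral with a theta function in the denominator

Write `J(a)` for the left-hand side, as a function of `a`. The proof is a first-order recurrence
in `a` together with the limit of `J(a q ^ n)`.

*Recurrence.* With `h(x) = (q x², 1/x²)_∞ / ((aqx, a/x, bqx, b/x, cqx, c/x)_∞ θ(ux, u/x))`, the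
weight `x F(x)` times `(1 - ab)(1 - ac) - bc (1 - ax)(1 - a/x)` equals the `q`-difference
`h(x) - h(x/q)` (`integrand_eq_antiInvariant_add`, which uses `h(x/q) = -h(1/x)`). Multiplying
`F` by `(1 - ax)(1 - a/x)` shifts `a` to `aq`, so `(1 - ab)(1 - ac) J(a) - bc J(aq)` is the
integral of a `q`-difference plus its residues. The residues telescope (`residueValue_recurrence`),
the integral is computed from the two simple poles of `h` between `|x| = 1` and `|x| = 1/q`
(`circleIntegral_antiInvariant`), and the two contributions cancel. Hence
`(1 - ab)(1 - ac) J(a) = bc J(aq)` (`integralPlusResidues_recurrence`).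

*Limit.* Iterating, `(ab, ac; q)_∞ J(a)` is the limit of `(bc) ^ n J(a q ^ n)`. The integral is
bounded in `n`, so it drops out. The residue at `u q ^ (-k)` has a closed form (`residueValue`,
`complexResidue_integrand`), because the Gaussian factors coming from the quasi-periodicity of the
theta functions cancel up to `(bc) ^ (-k)`. Putting `k = n - m` and passing to the limit termwise
gives a constant times the bilateral series `∑ (bc) ^ m / (a u q ^ m; q)_∞` over all integers `m`
(`tendsto_tsum_residueValue`).

*Bilateral series.* This is Ramanujan's `₁ψ₁` series with lower parameter zero. Euler's expansion
of `(q ^ (1 - m) / w; q)_∞` turns it into a product of a theta series and `1 / (bc; q)_∞`, and the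
same identity at `w = 1` is the Jacobi triple product (`hasSum_thetaTerm_mul_qPoch`,
`tsum_thetaTerm`, `hasSum_zpow_div_qPoch`).
-/

open Filter

/-! ### The infinite shifted factorial -/

lemma norm_ofReal_lt_one {q : ℝ} (hq0 : 0 < q) (hq1 : q < 1) : ‖(q : ℂ)‖ < 1 := by
  rwa [Complex.norm_real, Real.norm_of_nonneg hq0.le]

lemma summable_norm_mul_pow {q : ℝ} (hq0 : 0 < q) (hq1 : q < 1) (x : ℂ) :
    Summable fun i : ℕ => ‖-(x * (q : ℂ) ^ i)‖ := by
  simp only [norm_neg, norm_mul, norm_pow]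
  exact (summable_geometric_of_lt_one (norm_nonneg _) (norm_ofReal_lt_one hq0 hq1)).mul_left _

lemma multipliable_qPoch {q : ℝ} (hq0 : 0 < q) (hq1 : q < 1) (x : ℂ) :
    Multipliable fun i : ℕ => 1 - x * (q : ℂ) ^ i := by
  simpa [sub_eq_add_neg] using multipliable_one_add_of_summable (summable_norm_mul_pow hq0 hq1 x)

lemma qPoch_eq_mul {q : ℝ} (hq0 : 0 < q) (hq1 : q < 1) (x : ℂ) :
    qPoch q x = (1 - x) * qPoch q (x * q) := by
  unfold qPoch
  rw [tprod_eq_zero_mul']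
  · simp [pow_succ', mul_assoc]
  · simpa [pow_succ', mul_assoc] using multipliable_qPoch hq0 hq1 (x * q)

lemma qPoch_eq_prod_mul {q : ℝ} (hq0 : 0 < q) (hq1 : q < 1) (x : ℂ) (n : ℕ) :
    qPoch q x = (∏ i ∈ Finset.range n, (1 - x * (q : ℂ) ^ i)) * qPoch q (x * (q : ℂ) ^ n) := by
  induction n with
  | zero => simp
  | succ n ih =>
    rw [ih, qPoch_eq_mul hq0 hq1 (x * (q : ℂ) ^ n), Finset.prod_range_succ, pow_succ]
    ring_nf

@[simp] lemma qPoch_zero (q : ℝ) : qPoch q 0 = 1 := by simp [qPoch]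

lemma qPoch_ne_zero {q : ℝ} (hq0 : 0 < q) (hq1 : q < 1) {x : ℂ}
    (hx : ∀ n : ℕ, x * (q : ℂ) ^ n ≠ 1) : qPoch q x ≠ 0 := by
  have := tprod_one_add_ne_zero_of_summable (f := fun i : ℕ => -(x * (q : ℂ) ^ i))
    (fun i => by rw [← sub_eq_add_neg, sub_ne_zero]; exact (hx i).symm)
    (summable_norm_mul_pow hq0 hq1 x)
  simpa [qPoch, sub_eq_add_neg] using this

lemma qPoch_ne_zero_of_norm_lt_one {q : ℝ} (hq0 : 0 < q) (hq1 : q < 1) {x : ℂ} (hx : ‖x‖ < 1) :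
    qPoch q x ≠ 0 := by
  refine qPoch_ne_zero hq0 hq1 fun n h => ?_
  have h1 : ‖x * (q : ℂ) ^ n‖ < 1 := by
    rw [norm_mul, norm_pow]
    exact mul_lt_one_of_nonneg_of_lt_one_left (norm_nonneg _) hx
      (pow_le_one₀ (norm_nonneg _) (norm_ofReal_lt_one hq0 hq1).le)
  rw [h, norm_one] at h1
  exact lt_irrefl _ h1

lemma qPoch_eq_zero {q : ℝ} (hq0 : 0 < q) (hq1 : q < 1) {x : ℂ} (n : ℕ)
    (hx : x * (q : ℂ) ^ n = 1) : qPoch q x = 0 := by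
  rw [qPoch_eq_prod_mul hq0 hq1 x (n + 1), Finset.prod_range_succ, hx]
  simp

lemma differentiable_qPoch {q : ℝ} (hq0 : 0 < q) (hq1 : q < 1) :
    Differentiable ℂ (qPoch q) := by
  have key : MultipliableLocallyUniformlyOn (fun (n : ℕ) (x : ℂ) => 1 + -(x * (q : ℂ) ^ n))
      (Set.univ : Set ℂ) := by
    use fun x => ∏' n : ℕ, (1 + -(x * (q : ℂ) ^ n))
    apply hasProdLocallyUniformlyOn_of_forall_compact isOpen_univ
    intro K _ hcK
    obtain ⟨C, hC⟩ := hcK.isBounded.exists_norm_le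
    refine ((summable_geometric_of_lt_one (norm_nonneg _)
      (norm_ofReal_lt_one hq0 hq1)).mul_left C).hasProdUniformlyOn_nat_one_add
      hcK (.of_forall fun n x hx => ?_) (fun _ => by fun_prop)
    rw [norm_neg, norm_mul, norm_pow]
    exact mul_le_mul_of_nonneg_right (hC x hx) (by positivity)
  rw [← differentiableOn_univ]
  have := key.hasProdLocallyUniformlyOn.differentiableOn
    (.of_forall fun _ => by simpa [Finset.prod_fn] using
      DifferentiableOn.finsetProd (fun _ _ => by fun_prop)) isOpen_univ
  simp only [← sub_eq_add_neg] at this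
  exact this

lemma continuous_qPoch {q : ℝ} (hq0 : 0 < q) (hq1 : q < 1) : Continuous (qPoch q) :=
  (differentiable_qPoch hq0 hq1).continuous

lemma tendsto_ofReal_pow {q : ℝ} (hq0 : 0 < q) (hq1 : q < 1) :
    Tendsto (fun n : ℕ => (q : ℂ) ^ n) atTop (𝓝 0) :=
  tendsto_pow_atTop_nhds_zero_of_norm_lt_one (norm_ofReal_lt_one hq0 hq1)

lemma tendsto_prod_qPoch {q : ℝ} (hq0 : 0 < q) (hq1 : q < 1) (x : ℂ) :
    Tendsto (fun n : ℕ => ∏ i ∈ Finset.range n, (1 - x * (q : ℂ) ^ i)) atTop (𝓝 (qPoch q x)) :=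
  (multipliable_qPoch hq0 hq1 x).hasProd.tendsto_prod_nat

lemma exists_norm_qPoch_le {q : ℝ} (hq0 : 0 < q) (hq1 : q < 1) (r : ℝ) :
    ∃ C : ℝ, 0 < C ∧ ∀ x : ℂ, ‖x‖ ≤ r → ‖qPoch q x‖ ≤ C := by
  obtain ⟨C, hC⟩ := (isCompact_closedBall (0 : ℂ) r).exists_bound_of_continuousOn
    (continuous_qPoch hq0 hq1).continuousOn
  exact ⟨max C 1, by positivity, fun x hx => (hC x (by simpa using hx)).trans (le_max_left _ _)⟩

lemma exists_norm_inv_qPoch_le {q : ℝ} (hq0 : 0 < q) (hq1 : q < 1) {r : ℝ} (hr : r < 1) :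
    ∃ C : ℝ, 0 < C ∧ ∀ x : ℂ, ‖x‖ ≤ r → ‖(qPoch q x)⁻¹‖ ≤ C := by
  obtain ⟨C, hC⟩ := (isCompact_closedBall (0 : ℂ) r).exists_bound_of_continuousOn
    (f := fun x => (qPoch q x)⁻¹) ((continuous_qPoch hq0 hq1).continuousOn.inv₀ fun x hx =>
      qPoch_ne_zero_of_norm_lt_one hq0 hq1 ((by simpa using hx : ‖x‖ ≤ r).trans_lt hr))
  exact ⟨max C 1, by positivity, fun x hx => (hC x (by simpa using hx)).trans (le_max_left _ _)⟩

/-! ### Euler's two expansions -/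

/-- The finite `q`-shifted factorial `(q; q)_n = (1 - q) ⋯ (1 - q ^ n)`. -/
noncomputable def qFac (q : ℝ) (n : ℕ) : ℂ :=
  ∏ i ∈ Finset.range n, (1 - (q : ℂ) * (q : ℂ) ^ i)

@[simp] lemma qFac_zero (q : ℝ) : qFac q 0 = 1 := by simp [qFac]

lemma qFac_succ (q : ℝ) (n : ℕ) : qFac q (n + 1) = qFac q n * (1 - (q : ℂ) ^ (n + 1)) := by
  rw [qFac, Finset.prod_range_succ, ← qFac, pow_succ']

lemma one_sub_pow_ne_zero {q : ℝ} (hq0 : 0 < q) (hq1 : q < 1) (n : ℕ) :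
    1 - (q : ℂ) ^ (n + 1) ≠ 0 := by
  rw [sub_ne_zero]
  exact_mod_cast (pow_lt_one₀ hq0.le hq1 (Nat.succ_ne_zero n)).ne'

lemma qFac_ne_zero {q : ℝ} (hq0 : 0 < q) (hq1 : q < 1) (n : ℕ) : qFac q n ≠ 0 := by
  induction n with
  | zero => simp
  | succ n ih => rw [qFac_succ]; exact mul_ne_zero ih (one_sub_pow_ne_zero hq0 hq1 n)

/-- A power series converging at `x` tends to its constant term along `x q ^ n`. -/
lemma tendsto_tsum_mul_pow {q : ℝ} (hq0 : 0 < q) (hq1 : q < 1) {c : ℕ → ℂ} {x : ℂ}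
    (hc : Summable fun j => ‖c j * x ^ j‖) :
    Tendsto (fun n : ℕ => ∑' j, c j * (x * (q : ℂ) ^ n) ^ j) atTop (𝓝 (c 0)) := by
  have h0 : c 0 = ∑' j : ℕ, if j = 0 then c 0 else 0 := by rw [tsum_ite_eq]
  rw [h0]
  refine tendsto_tsum_of_dominated_convergence hc (fun j => ?_) (.of_forall fun n j => ?_)
  · rcases j with _ | j
    · simp
    · have h := ((tendsto_ofReal_pow hq0 hq1).const_mul x).pow (j + 1)
      simpa using h.const_mul (c (j + 1))
  · rw [mul_pow, ← mul_assoc, norm_mul _ (((q : ℂ) ^ n) ^ j), norm_pow, norm_pow]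
    exact mul_le_of_le_one_right (norm_nonneg _) (pow_le_one₀ (by positivity)
      (pow_le_one₀ (norm_nonneg _) (norm_ofReal_lt_one hq0 hq1).le))

lemma tendsto_one_sub_pow {q : ℝ} (hq0 : 0 < q) (hq1 : q < 1) :
    Tendsto (fun n : ℕ => 1 - (q : ℂ) ^ (n + 1)) atTop (𝓝 1) := by
  simpa using ((tendsto_ofReal_pow hq0 hq1).comp (tendsto_add_atTop_nat 1)).const_sub 1

/-- Ratio test for a complex series given by its consecutive quotients. -/
lemma summable_norm_of_ratio {f g : ℕ → ℂ} {l : ℂ} (hl : ‖l‖ < 1) (hf : ∀ n, f n ≠ 0)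
    (hg : ∀ n, f (n + 1) = g n * f n) (h : Tendsto g atTop (𝓝 l)) :
    Summable fun n => ‖f n‖ := by
  refine summable_of_ratio_test_tendsto_lt_one hl (.of_forall fun n => norm_ne_zero_iff.2 (hf n))
    (h.norm.congr fun n => ?_)
  rw [norm_norm, norm_norm, hg, norm_mul, mul_div_cancel_right₀ _ (norm_ne_zero_iff.2 (hf n))]

lemma summable_pow_div_qFac {q : ℝ} (hq0 : 0 < q) (hq1 : q < 1) {x : ℂ} (hx : ‖x‖ < 1) :
    Summable fun j => ‖(qFac q j)⁻¹ * x ^ j‖ := by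
  rcases eq_or_ne x 0 with rfl | hx0
  · exact summable_of_ne_finset_zero (s := {0}) fun j hj => by
      simp [show j ≠ 0 by simpa using hj]
  refine summable_norm_of_ratio (g := fun n => (1 - (q : ℂ) ^ (n + 1))⁻¹ * x) (l := x) hx
    (fun n => mul_ne_zero (inv_ne_zero (qFac_ne_zero hq0 hq1 n)) (pow_ne_zero _ hx0))
    (fun n => ?_) ?_
  · rw [qFac_succ, mul_inv, pow_succ]; ring
  · simpa using ((tendsto_one_sub_pow hq0 hq1).inv₀ one_ne_zero).mul_const x

/-- Euler's expansion of `1 / (x; q)_∞`. -/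
lemma tsum_pow_div_qFac {q : ℝ} (hq0 : 0 < q) (hq1 : q < 1) {x : ℂ} (hx : ‖x‖ < 1) :
    ∑' j, (qFac q j)⁻¹ * x ^ j = (qPoch q x)⁻¹ := by
  set f : ℂ → ℂ := fun x => ∑' j, (qFac q j)⁻¹ * x ^ j with hf
  have hlt : ∀ n : ℕ, ‖x * (q : ℂ) ^ n‖ < 1 := fun n => by
    rw [norm_mul, norm_pow]
    exact mul_lt_one_of_nonneg_of_lt_one_left (norm_nonneg _) hx
      (pow_le_one₀ (norm_nonneg _) (norm_ofReal_lt_one hq0 hq1).le)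
  have hstep : ∀ y : ℂ, ‖y‖ < 1 → ‖y * q‖ < 1 → f (y * q) = (1 - y) * f y := by
    intro y hy hyq
    have s1 := (summable_pow_div_qFac hq0 hq1 hy).of_norm
    have s2 := (summable_pow_div_qFac hq0 hq1 hyq).of_norm
    have h1 : f y - f (y * q) = y * f y := by
      simp only [hf]
      rw [← s1.tsum_sub s2, (s1.sub s2).tsum_eq_zero_add, ← tsum_mul_left]
      simp only [pow_zero, sub_self, zero_add]
      refine tsum_congr fun j => ?_
      rw [qFac_succ]
      have := one_sub_pow_ne_zero hq0 hq1 j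
      have := qFac_ne_zero hq0 hq1 j
      field_simp
      ring
    linear_combination -h1
  have hiter : ∀ n : ℕ, f (x * (q : ℂ) ^ n) =
      (∏ i ∈ Finset.range n, (1 - x * (q : ℂ) ^ i)) * f x := by
    intro n
    induction n with
    | zero => simp
    | succ n ih =>
      have e : x * (q : ℂ) ^ (n + 1) = x * (q : ℂ) ^ n * q := by ring
      rw [e, hstep _ (hlt n) (e ▸ hlt (n + 1)), ih, Finset.prod_range_succ]
      ring
  have hlim := tendsto_tsum_mul_pow hq0 hq1 (summable_pow_div_qFac hq0 hq1 hx)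
  have hlim' := (tendsto_prod_qPoch hq0 hq1 x).mul_const (f x)
  have h := tendsto_nhds_unique hlim (hlim'.congr fun n => (hiter n).symm)
  rw [qFac_zero, inv_one] at h
  exact eq_inv_of_mul_eq_one_right h.symm

lemma summable_choose_div_qFac {q : ℝ} (hq0 : 0 < q) (hq1 : q < 1) (x : ℂ) :
    Summable fun j => ‖(-1) ^ j * (q : ℂ) ^ (j.choose 2) * (qFac q j)⁻¹ * x ^ j‖ := by
  rcases eq_or_ne x 0 with rfl | hx0
  · exact summable_of_ne_finset_zero (s := {0}) fun j hj => by
      simp [show j ≠ 0 by simpa using hj]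
  have hqc : (q : ℂ) ≠ 0 := by exact_mod_cast hq0.ne'
  refine summable_norm_of_ratio (l := 0)
    (g := fun n => (1 - (q : ℂ) ^ (n + 1))⁻¹ * (-x * (q : ℂ) ^ n)) (by simp)
    (fun n => mul_ne_zero (mul_ne_zero (mul_ne_zero (by simp) (pow_ne_zero _ hqc))
      (inv_ne_zero (qFac_ne_zero hq0 hq1 n))) (pow_ne_zero _ hx0))
    (fun n => ?_) ?_
  · rw [qFac_succ, mul_inv, pow_succ, Nat.choose_succ_succ' n 1, pow_add, Nat.choose_one_right]
    ring
  · simpa using ((tendsto_one_sub_pow hq0 hq1).inv₀ one_ne_zero).mul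
      ((tendsto_ofReal_pow hq0 hq1).const_mul (-x))

/-- Euler's expansion of `(x; q)_∞`. -/
lemma tsum_choose_div_qFac {q : ℝ} (hq0 : 0 < q) (hq1 : q < 1) (x : ℂ) :
    ∑' j, (-1) ^ j * (q : ℂ) ^ (j.choose 2) * (qFac q j)⁻¹ * x ^ j = qPoch q x := by
  set f : ℂ → ℂ := fun x => ∑' j, (-1) ^ j * (q : ℂ) ^ (j.choose 2) * (qFac q j)⁻¹ * x ^ j with hf
  have hstep : ∀ y : ℂ, f y = (1 - y) * f (y * q) := by
    intro y
    have s1 := (summable_choose_div_qFac hq0 hq1 y).of_norm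
    have s2 := (summable_choose_div_qFac hq0 hq1 (y * q)).of_norm
    have h1 : f y - f (y * q) = -y * f (y * q) := by
      simp only [hf]
      rw [← s1.tsum_sub s2, (s1.sub s2).tsum_eq_zero_add, ← tsum_mul_left]
      simp only [pow_zero, sub_self, zero_add]
      refine tsum_congr fun j => ?_
      rw [qFac_succ, Nat.choose_succ_succ' j 1, pow_add, Nat.choose_one_right]
      have := one_sub_pow_ne_zero hq0 hq1 j
      have := qFac_ne_zero hq0 hq1 j
      field_simp
      ring
    linear_combination h1
  have hiter : ∀ n : ℕ, f x =
      (∏ i ∈ Finset.range n, (1 - x * (q : ℂ) ^ i)) * f (x * (q : ℂ) ^ n) := by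
    intro n
    induction n with
    | zero => simp
    | succ n ih =>
      rw [ih, hstep (x * (q : ℂ) ^ n), Finset.prod_range_succ, pow_succ]
      ring_nf
  have hlim := tendsto_tsum_mul_pow hq0 hq1 (summable_choose_div_qFac hq0 hq1 x)
  have hlim' := (tendsto_prod_qPoch hq0 hq1 x).mul hlim
  have h := tendsto_nhds_unique tendsto_const_nhds (hlim'.congr fun n => (hiter n).symm)
  simpa using h

/-! ### The theta function, the triple product and a bilateral sum -/

lemma qTheta_eq (q : ℝ) (x : ℂ) : qTheta q x = qPoch q x * qPoch q (q / x) := by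
  simp [qTheta, qPochs]

/-- The triangular number `l (l - 1) / 2` of an integer `l`. -/
def triangle (l : ℤ) : ℤ := l * (l - 1) / 2

lemma two_mul_triangle (l : ℤ) : 2 * triangle l = l * (l - 1) :=
  Int.mul_ediv_cancel' (Int.even_mul_pred_self l).two_dvd

lemma triangle_add_one (l : ℤ) : triangle (l + 1) = triangle l + l := by
  have h1 := two_mul_triangle (l + 1)
  have h2 := two_mul_triangle l
  linarith

lemma triangle_natCast (n : ℕ) : triangle n = (n.choose 2 : ℕ) := by
  induction n with
  | zero => simp [triangle]
  | succ n ih =>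
    rw [Nat.cast_succ, triangle_add_one, ih, Nat.choose_succ_succ' n 1, Nat.choose_one_right]
    push_cast
    ring

lemma triangle_neg (l : ℤ) : triangle (-l) = triangle l + l := by
  have h1 := two_mul_triangle (-l)
  have h2 := two_mul_triangle l
  linarith

lemma triangle_sub (m j : ℤ) : triangle (m - j) = triangle m + j * (1 - m) + triangle j := by
  have h1 := two_mul_triangle (m - j)
  have h2 := two_mul_triangle m
  have h3 := two_mul_triangle j
  linarith

lemma qTheta_mul_q {q : ℝ} (hq0 : 0 < q) (hq1 : q < 1) {x : ℂ} (hx : x ≠ 0) :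
    qTheta q (x * q) = -x⁻¹ * qTheta q x := by
  have hqc : (q : ℂ) ≠ 0 := by exact_mod_cast hq0.ne'
  have e1 : (q : ℂ) / (x * q) = 1 / x := by field_simp
  have e2 : 1 / x * (q : ℂ) = q / x := by ring
  rw [qTheta_eq, qTheta_eq, qPoch_eq_mul hq0 hq1 x, e1, qPoch_eq_mul hq0 hq1 (1 / x), e2]
  field_simp
  ring

lemma qTheta_mul_zpow {q : ℝ} (hq0 : 0 < q) (hq1 : q < 1) {x : ℂ} (hx : x ≠ 0) (m : ℤ) :
    qTheta q (x * (q : ℂ) ^ m) = (-x) ^ (-m) * (q : ℂ) ^ (-triangle m) * qTheta q x := by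
  have hqc : (q : ℂ) ≠ 0 := by exact_mod_cast hq0.ne'
  have hstep : ∀ m : ℤ, qTheta q (x * (q : ℂ) ^ (m + 1)) =
      -(x * (q : ℂ) ^ m)⁻¹ * qTheta q (x * (q : ℂ) ^ m) := fun m => by
    rw [← qTheta_mul_q hq0 hq1 (mul_ne_zero hx (zpow_ne_zero _ hqc)), zpow_add_one₀ hqc, mul_assoc]
  have hfac : ∀ m : ℤ, (-x) ^ (-(m + 1)) * (q : ℂ) ^ (-triangle (m + 1)) =
      -(x * (q : ℂ) ^ m)⁻¹ * ((-x) ^ (-m) * (q : ℂ) ^ (-triangle m)) := fun m => by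
    rw [triangle_add_one, neg_add, neg_add, zpow_add₀ (neg_ne_zero.2 hx), zpow_add₀ hqc,
      zpow_neg_one, zpow_neg (q : ℂ) m]
    have := zpow_ne_zero m hqc
    field_simp
  induction m using Int.induction_on with
  | zero => simp [triangle]
  | succ m ih => rw [hstep, ih, hfac]; ring
  | pred m ih =>
    have h1 := hstep (-(m : ℤ) - 1)
    have h2 := hfac (-(m : ℤ) - 1)
    rw [sub_add_cancel] at h1 h2
    rw [ih, h2] at h1
    have h3 : -(x * (q : ℂ) ^ (-(m : ℤ) - 1))⁻¹ ≠ 0 :=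
      neg_ne_zero.2 (inv_ne_zero (mul_ne_zero hx (zpow_ne_zero _ hqc)))
    rw [mul_assoc] at h1
    exact (mul_left_cancel₀ h3 h1).symm

lemma qPoch_ne_zero_of_zpow {q : ℝ} (hq0 : 0 < q) (hq1 : q < 1) {x : ℂ}
    (h : ∀ n : ℤ, x ≠ (q : ℂ) ^ n) : qPoch q x ≠ 0 := by
  have hqc : (q : ℂ) ≠ 0 := by exact_mod_cast hq0.ne'
  refine qPoch_ne_zero hq0 hq1 fun n hn => h (-n) ?_
  rw [zpow_neg, zpow_natCast]
  exact eq_inv_of_mul_eq_one_left hn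

lemma qTheta_ne_zero {q : ℝ} (hq0 : 0 < q) (hq1 : q < 1) {x : ℂ} (hx : x ≠ 0)
    (h : ∀ n : ℤ, x ≠ (q : ℂ) ^ n) : qTheta q x ≠ 0 := by
  have hqc : (q : ℂ) ≠ 0 := by exact_mod_cast hq0.ne'
  rw [qTheta_eq]
  refine mul_ne_zero (qPoch_ne_zero_of_zpow hq0 hq1 h)
    (qPoch_ne_zero_of_zpow hq0 hq1 fun n hn => h (1 - n) ?_)
  rw [zpow_sub₀ hqc, ← hn, zpow_one]
  field_simp

/-- Two-sided ratio test for a complex series over the integers. -/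
lemma summable_int_of_ratio {f : ℤ → ℂ} {g g' : ℕ → ℂ} {l l' : ℂ} (hl : ‖l‖ < 1) (hl' : ‖l'‖ < 1)
    (hf : ∀ n, f n ≠ 0) (hg : ∀ n : ℕ, f (n + 1) = g n * f n)
    (hg' : ∀ n : ℕ, f (-(n + 1)) = g' n * f (-n)) (h : Tendsto g atTop (𝓝 l))
    (h' : Tendsto g' atTop (𝓝 l')) : Summable fun n => ‖f n‖ := by
  refine Summable.of_nat_of_neg (summable_norm_of_ratio hl (fun n => hf _) (fun n => ?_) h)
    (summable_norm_of_ratio (f := fun n : ℕ => f (-n)) hl' (fun n => hf _) (fun n => ?_) h')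
  · exact_mod_cast hg n
  · exact_mod_cast hg' n

/-- The general term `(-x) ^ l q ^ (l (l - 1) / 2)` of the theta series. -/
noncomputable def thetaTerm (q : ℝ) (x : ℂ) (l : ℤ) : ℂ := (-x) ^ l * (q : ℂ) ^ triangle l

lemma summable_thetaTerm {q : ℝ} (hq0 : 0 < q) (hq1 : q < 1) {x : ℂ} (hx : x ≠ 0) :
    Summable fun l => ‖thetaTerm q x l‖ := by
  have hqc : (q : ℂ) ≠ 0 := by exact_mod_cast hq0.ne'
  have hx' := neg_ne_zero.2 hx
  refine summable_int_of_ratio (g := fun n => -x * (q : ℂ) ^ n) (l := 0) (l' := 0)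
    (g' := fun n => (-x)⁻¹ * q * (q : ℂ) ^ n) (by simp) (by simp)
    (fun n => mul_ne_zero (zpow_ne_zero _ hx') (zpow_ne_zero _ hqc)) (fun n => ?_) (fun n => ?_)
    (by simpa using (tendsto_ofReal_pow hq0 hq1).const_mul (-x))
    (by simpa using (tendsto_ofReal_pow hq0 hq1).const_mul ((-x)⁻¹ * q))
  · rw [thetaTerm, thetaTerm, triangle_add_one, zpow_add₀ hqc, zpow_add_one₀ hx', zpow_natCast,
      zpow_natCast]
    ring
  · rw [thetaTerm, thetaTerm, triangle_neg, triangle_neg, triangle_add_one, neg_add,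
      zpow_add₀ hx', zpow_add₀ hqc, zpow_add₀ hqc, zpow_add₀ hqc, zpow_neg_one,
      zpow_natCast, zpow_one]
    ring

/-- Expanding `(q ^ (1 - m) / w; q)_∞` by Euler's formula and summing along the shifted
index `m - j` factors the bilateral sum into a theta series and a geometric-type series. -/
lemma hasSum_thetaTerm_mul_qPoch {q : ℝ} (hq0 : 0 < q) (hq1 : q < 1) {w z : ℂ} (hw : w ≠ 0)
    (hz : z ≠ 0) (hz1 : ‖z‖ < 1) :
    HasSum (fun m : ℤ => thetaTerm q (w * z) m * qPoch q ((q : ℂ) ^ (1 - m) / w))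
      ((∑' l, thetaTerm q (w * z) l) * (qPoch q z)⁻¹) := by
  have hqc : (q : ℂ) ≠ 0 := by exact_mod_cast hq0.ne'
  have hwz : -(w * z) ≠ 0 := neg_ne_zero.2 (mul_ne_zero hw hz)
  have sA := summable_thetaTerm hq0 hq1 (mul_ne_zero hw hz)
  have sB := summable_pow_div_qFac hq0 hq1 hz1
  have hprod : HasSum (fun p : ℤ × ℕ => thetaTerm q (w * z) p.1 * ((qFac q p.2)⁻¹ * z ^ p.2))
      ((∑' l, thetaTerm q (w * z) l) * (qPoch q z)⁻¹) := by
    rw [← tsum_pow_div_qFac hq0 hq1 hz1, tsum_mul_tsum_of_summable_norm sA sB]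
    exact (summable_mul_of_summable_norm sA sB).hasSum
  -- the substitution `l = m - j` in the double series
  let e : ℤ × ℕ ≃ ℤ × ℕ :=
    { toFun := fun p => (p.1 - p.2, p.2)
      invFun := fun p => (p.1 + p.2, p.2)
      left_inv := fun p => by simp
      right_inv := fun p => by simp }
  refine (e.hasSum_iff.2 hprod).prod_fiberwise fun m => ?_
  have hE := ((summable_choose_div_qFac hq0 hq1 ((q : ℂ) ^ (1 - m) / w)).of_norm.hasSum)
  rw [tsum_choose_div_qFac hq0 hq1] at hE
  convert! hE.mul_left (thetaTerm q (w * z) m) using 2 with j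
  simp only [e, Function.comp, Equiv.coe_fn_mk, thetaTerm]
  rw [triangle_sub, zpow_add₀ hqc, zpow_add₀ hqc, triangle_natCast, zpow_natCast, div_pow,
    zpow_sub₀ hwz, zpow_natCast, mul_comm (j : ℤ), zpow_mul, zpow_natCast, neg_pow (w * z) j,
    mul_pow]
  have h1 : ((-1 : ℂ) ^ j) * (-1) ^ j = 1 := by rw [← mul_pow]; simp
  have h2 : (-1 : ℂ) ^ j ≠ 0 := by simp
  have := qFac_ne_zero hq0 hq1 j
  field_simp
  linear_combination (-1) * h1

/-- The Jacobi triple product in the disc `0 < |x| < 1`: the case `w = 1` of the factorization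
of the bilateral sum, where the terms with `m > 0` vanish. -/
lemma tsum_thetaTerm {q : ℝ} (hq0 : 0 < q) (hq1 : q < 1) {x : ℂ} (hx : x ≠ 0) (hx1 : ‖x‖ < 1) :
    ∑' l, thetaTerm q x l = qPoch q q * qTheta q x := by
  have hqc : (q : ℂ) ≠ 0 := by exact_mod_cast hq0.ne'
  have h := (hasSum_thetaTerm_mul_qPoch hq0 hq1 one_ne_zero hx hx1).tsum_eq
  simp only [one_mul, div_one] at h
  have hinj : Function.Injective (fun n : ℕ => -(n : ℤ)) := fun a b hab => by simpa using hab
  rw [← hinj.tsum_eq] at h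
  · have hterm : ∀ n : ℕ, thetaTerm q x (-(n : ℤ)) * qPoch q ((q : ℂ) ^ (1 - -(n : ℤ))) =
        qPoch q q * ((-1) ^ n * (q : ℂ) ^ (n.choose 2) * (qFac q n)⁻¹ * (q / x) ^ n) := fun n => by
      have e : (q : ℂ) ^ (1 - -(n : ℤ)) = q * (q : ℂ) ^ n := by
        rw [sub_neg_eq_add, zpow_add₀ hqc, zpow_one, zpow_natCast]
      rw [e, qPoch_eq_prod_mul hq0 hq1 (q : ℂ) n, ← qFac, thetaTerm, triangle_neg,
        triangle_natCast, zpow_add₀ hqc, zpow_natCast, zpow_natCast, zpow_neg, zpow_natCast,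
        neg_pow x, div_pow]
      have h1 : ((-1 : ℂ) ^ n) * (-1) ^ n = 1 := by rw [← mul_pow]; simp
      have h2 : (-1 : ℂ) ^ n ≠ 0 := by simp
      have := qFac_ne_zero hq0 hq1 n
      generalize qPoch q (q * (q : ℂ) ^ n) = P
      field_simp
      linear_combination (-P) * h1
    simp only [hterm] at h
    rw [tsum_mul_left, tsum_choose_div_qFac hq0 hq1] at h
    have := qPoch_ne_zero_of_norm_lt_one hq0 hq1 hx1
    rw [qTheta_eq, mul_left_comm, h]
    field_simp
  · intro m hm
    by_contra hcon
    have hm1 : 1 ≤ m := by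
      by_contra hlt
      exact hcon ⟨m.natAbs, by simp only; omega⟩
    refine hm ?_
    simp only
    rw [qPoch_eq_zero hq0 hq1 (m - 1).toNat, mul_zero]
    rw [← zpow_natCast, Int.toNat_of_nonneg (by omega), ← zpow_add₀ hqc]
    simp

/-- The case `b = 0` of Ramanujan's `₁ψ₁` sum. -/
lemma hasSum_zpow_div_qPoch {q : ℝ} (hq0 : 0 < q) (hq1 : q < 1) {w z : ℂ} (hw : w ≠ 0)
    (hwq : ∀ n : ℤ, w ≠ (q : ℂ) ^ n) (hz : z ≠ 0) (hz1 : ‖z‖ < 1) (hwz : ‖w * z‖ < 1) :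
    HasSum (fun m : ℤ => z ^ m / qPoch q (w * (q : ℂ) ^ m))
      (qPoch q q * qTheta q (w * z) / (qTheta q w * qPoch q z)) := by
  have hqc : (q : ℂ) ≠ 0 := by exact_mod_cast hq0.ne'
  have hθ := qTheta_ne_zero hq0 hq1 hw hwq
  have h := (hasSum_thetaTerm_mul_qPoch hq0 hq1 hw hz hz1).div_const (qTheta q w)
  rw [tsum_thetaTerm hq0 hq1 (mul_ne_zero hw hz) hwz] at h
  convert! h using 1
  · funext m
    have hne : qPoch q (w * (q : ℂ) ^ m) ≠ 0 := qPoch_ne_zero_of_zpow hq0 hq1 fun n hn =>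
      hwq (n - m) (by rw [zpow_sub₀ hqc, ← hn, mul_div_cancel_right₀ _ (zpow_ne_zero _ hqc)])
    have h1 := qTheta_mul_zpow hq0 hq1 hw m
    rw [qTheta_eq] at h1
    have e : (q : ℂ) / (w * (q : ℂ) ^ m) = (q : ℂ) ^ (1 - m) / w := by
      rw [zpow_sub₀ hqc, zpow_one]
      have := zpow_ne_zero m hqc
      field_simp
    rw [e] at h1
    rw [div_eq_div_iff hne hθ, thetaTerm, mul_assoc, mul_comm (qPoch q (_ / w)), h1, zpow_neg,
      zpow_neg, ← neg_mul, mul_zpow]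
    have := zpow_ne_zero m hqc
    have := zpow_ne_zero (triangle m) hqc
    have := zpow_ne_zero m (neg_ne_zero.2 hw)
    field_simp
  · field_simp

/-! ### Residues and contour integrals -/

/-- The residue at a simple pole, in the form `f = N / (x - p)` near `p`. -/
lemma complexResidue_eq_of_simple_pole {f N : ℂ → ℂ} {p : ℂ}
    (hN : ∀ᶠ x in 𝓝 p, DifferentiableAt ℂ N x)
    (hf : ∀ᶠ x in 𝓝[≠] p, f x = N x / (x - p)) :
    complexResidue f p = N p ∧ MeromorphicAt f p := by
  have hpi : 2 * (Real.pi : ℂ) * Complex.I ≠ 0 := Complex.two_pi_I_ne_zero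
  rw [eventually_nhdsWithin_iff] at hf
  obtain ⟨ε, hε, hball⟩ := Metric.eventually_nhds_iff_ball.1 (hN.and hf)
  constructor
  · refine Tendsto.limUnder_eq (tendsto_const_nhds.congr' ?_)
    filter_upwards [Ioo_mem_nhdsGT hε] with r hr
    have hsub : Metric.closedBall p r ⊆ Metric.ball p ε := Metric.closedBall_subset_ball hr.2
    have hcong : (∮ x in C(p, r), f x) = ∮ x in C(p, r), (x - p)⁻¹ • N x := by
      refine circleIntegral.integral_congr hr.1.le fun x hx => ?_
      rw [(hball x (hsub (Metric.sphere_subset_closedBall hx))).2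
        (Metric.ne_of_mem_sphere hx hr.1.ne'), smul_eq_mul, div_eq_inv_mul]
    have hd : DifferentiableOn ℂ N (Metric.closedBall p r) := fun x hx =>
      (hball x (hsub hx)).1.differentiableWithinAt
    rw [hcong, hd.circleIntegral_sub_inv_smul (Metric.mem_ball_self hr.1), smul_eq_mul,
      inv_mul_cancel_left₀ hpi]
  · have hd : DifferentiableOn ℂ N (Metric.ball p ε) := fun x hx =>
      (hball x hx).1.differentiableWithinAt
    have hm : MeromorphicAt (fun x => N x / (x - p)) p :=
      (hd.analyticAt (Metric.ball_mem_nhds p hε)).meromorphicAt.fun_div (by fun_prop)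
    refine hm.congr ?_
    rw [EventuallyEq, eventually_nhdsWithin_iff]
    filter_upwards [hf] with x hx hne
    exact (hx hne).symm

/-- Cauchy's integral formula on an annulus. -/
lemma circleIntegral_div_sub_annulus {N : ℂ → ℂ} {r R : ℝ} (hr : 0 < r) {p : ℂ} (hp : r < ‖p‖)
    (hpR : ‖p‖ < R) (hN : ∀ x, r ≤ ‖x‖ → ‖x‖ ≤ R → DifferentiableAt ℂ N x) :
    (∮ x in C(0, R), N x / (x - p)) - (∮ x in C(0, r), N x / (x - p)) =
      2 * Real.pi * Complex.I * N p := by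
  have hrR := hp.trans hpR
  have hds : ∀ x, r ≤ ‖x‖ → ‖x‖ ≤ R → ContinuousAt (dslope N p) x := fun x h1 h2 => by
    rcases eq_or_ne x p with rfl | hne
    · exact continuousAt_dslope_same.2 (hN x h1 h2)
    · exact (continuousAt_dslope_of_ne hne).2 (hN x h1 h2).continuousAt
  have hann := Complex.circleIntegral_eq_of_differentiable_on_annulus_off_countable (c := 0)
    (f := dslope N p) (s := {p}) hr hrR.le (Set.countable_singleton p)
    (fun x hx => (hds x (by simpa using hx.2) (by simpa using hx.1)).continuousWithinAt)
    (fun x hx => (differentiableAt_dslope_of_ne hx.2).2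
      (hN x (not_le.1 fun h => hx.1.2 (by simpa using h)).le (mem_ball_zero_iff.1 hx.1.1).le))
  have key : ∀ s, r ≤ s → s ≤ R → ‖p‖ ≠ s → (∮ x in C(0, s), N x / (x - p)) =
      (∮ x in C(0, s), dslope N p x) + N p * ∮ x in C(0, s), (x - p)⁻¹ := by
    intro s h1 h2 h3
    have hs0 : 0 ≤ s := hr.le.trans h1
    have hne : ∀ x ∈ Metric.sphere (0 : ℂ) s, x ≠ p := fun x hx hxp => by
      rw [hxp] at hx
      exact h3 (by simpa using hx)
    have i1 : CircleIntegrable (dslope N p) 0 s := by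
      refine ContinuousOn.circleIntegrable hs0 fun x hx => ?_
      have hx' : ‖x‖ = s := by simpa using hx
      exact (hds x (hx' ▸ h1) (hx' ▸ h2)).continuousWithinAt
    have i2 : CircleIntegrable (fun x => N p * (x - p)⁻¹) 0 s := by
      refine ContinuousOn.circleIntegrable hs0 (continuousOn_const.mul
        ((continuousOn_id.sub continuousOn_const).inv₀ fun x hx => sub_ne_zero.2 (hne x hx)))
    rw [← circleIntegral.integral_const_mul, ← circleIntegral.integral_add i1 i2]
    refine circleIntegral.integral_congr hs0 fun x hx => ?_
    rw [dslope_of_ne _ (hne x hx), slope_def_field]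
    have := sub_ne_zero.2 (hne x hx)
    field_simp
    ring
  have hR1 : (∮ x in C(0, R), (x - p)⁻¹) = 2 * Real.pi * Complex.I :=
    circleIntegral.integral_sub_inv_of_mem_ball (by simpa using hpR)
  have hr1 : (∮ x in C(0, r), (x - p)⁻¹) = 0 := by
    refine Complex.circleIntegral_eq_zero_of_differentiable_on_off_countable hr.le
      Set.countable_empty ?_ fun x hx => ?_
    · refine (continuousOn_id.sub continuousOn_const).inv₀ fun x hx => sub_ne_zero.2 ?_
      rintro rfl
      exact hp.not_ge (by simpa using hx)
    · have hne : x - p ≠ 0 := by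
        rw [sub_ne_zero]
        rintro rfl
        exact hp.not_gt (by simpa using hx.1)
      fun_prop (disch := assumption)
  rw [key R hrR.le le_rfl hpR.ne, key r le_rfl hrR.le hp.ne', hann, hR1, hr1]
  ring

/-- The difference of two circle integrals of a function with two simple poles in between. -/
lemma circleIntegral_div_sub_mul_sub_annulus {N : ℂ → ℂ} {r R : ℝ} (hr : 0 < r) {p p' : ℂ}
    (hp : r < ‖p‖) (hpR : ‖p‖ < R) (hp' : r < ‖p'‖) (hpR' : ‖p'‖ < R) (hne : p ≠ p')
    (hN : ∀ x, r ≤ ‖x‖ → ‖x‖ ≤ R → DifferentiableAt ℂ N x) :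
    (∮ x in C(0, R), N x / ((x - p) * (x - p'))) - (∮ x in C(0, r), N x / ((x - p) * (x - p'))) =
      2 * Real.pi * Complex.I * ((N p - N p') / (p - p')) := by
  have hsplit : ∀ s, r ≤ s → s ≤ R → ‖p‖ ≠ s → ‖p'‖ ≠ s →
      (∮ x in C(0, s), N x / ((x - p) * (x - p'))) =
        (p - p')⁻¹ * ((∮ x in C(0, s), N x / (x - p)) - ∮ x in C(0, s), N x / (x - p')) := by
    intro s h1 h2 h3 h4
    have hs0 : 0 ≤ s := hr.le.trans h1
    have hne1 : ∀ {y : ℂ}, ‖y‖ ≠ s → ∀ x ∈ Metric.sphere (0 : ℂ) s, x - y ≠ 0 :=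
      fun hy x hx => sub_ne_zero.2 fun hxp => by
        rw [hxp] at hx
        exact hy (by simpa using hx)
    have i : ∀ y : ℂ, ‖y‖ ≠ s → CircleIntegrable (fun x => N x / (x - y)) 0 s := fun y hy => by
      refine ContinuousOn.circleIntegrable hs0 (ContinuousOn.div (fun x hx => ?_)
        (continuousOn_id.sub continuousOn_const) (hne1 hy))
      have hx' : ‖x‖ = s := by simpa using hx
      exact (hN x (hx' ▸ h1) (hx' ▸ h2)).continuousAt.continuousWithinAt
    rw [← circleIntegral.integral_sub (i p h3) (i p' h4), ← circleIntegral.integral_const_mul]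
    refine circleIntegral.integral_congr hs0 fun x hx => ?_
    have e1 := hne1 h3 x hx
    have e2 := hne1 h4 x hx
    have e3 := sub_ne_zero.2 hne
    field_simp
    ring
  have hrR := hp.trans hpR
  rw [hsplit R hrR.le le_rfl hpR.ne hpR'.ne, hsplit r le_rfl hrR.le hp.ne' hp'.ne']
  have h1 := circleIntegral_div_sub_annulus hr hp hpR hN
  have h2 := circleIntegral_div_sub_annulus hr hp' hpR' hN
  rw [div_eq_inv_mul]
  linear_combination (p - p')⁻¹ * (h1 - h2)

/-- Inversion `x ↦ t / x` in an integral against `dx / x` over a centred circle. -/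
lemma circleIntegral_comp_inv_div (f : ℂ → ℂ) {t R : ℝ} (hR : R ≠ 0) (ht : t ≠ 0) :
    (∮ x in C(0, R), f (t / x) / x) = ∮ x in C(0, t / R), f x / x := by
  have hform : ∀ (g : ℂ → ℂ) (s : ℝ), s ≠ 0 → (∮ x in C(0, s), g x / x) =
      ∫ θ in (0 : ℝ)..2 * Real.pi, Complex.I * g (circleMap 0 s θ) := by
    intro g s hs
    rw [circleIntegral]
    refine intervalIntegral.integral_congr fun θ _ => ?_
    have := circleMap_ne_center (c := 0) (θ := θ) hs
    simp only [deriv_circleMap, smul_eq_mul]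
    field_simp
  have hcirc : ∀ θ : ℝ, (t : ℂ) / circleMap 0 R θ = circleMap 0 (t / R) (-θ) := fun θ => by
    have h1 : (R : ℂ) ≠ 0 := by exact_mod_cast hR
    simp only [circleMap, zero_add, Complex.ofReal_neg, neg_mul, Complex.exp_neg,
      Complex.ofReal_div]
    field_simp
  rw [hform _ R hR, hform f (t / R) (div_ne_zero ht hR)]
  simp only [hcirc]
  rw [intervalIntegral.integral_comp_neg (fun θ => Complex.I * f (circleMap 0 (t / R) θ)),
    neg_zero]
  have hper : Function.Periodic (fun θ => Complex.I * f (circleMap 0 (t / R) θ)) (2 * Real.pi) :=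
    fun θ => by simp only [periodic_circleMap 0 (t / R) θ]
  simpa using hper.intervalIntegral_add_eq (-(2 * Real.pi)) 0

/-! ### The residues of the integrand -/

/-- The standing assumptions on the parameters: sizes, and genericity. -/
structure IsGeneric (q : ℝ) (a b c u : ℂ) : Prop where
  hq0 : 0 < q
  hq1 : q < 1
  ha0 : a ≠ 0
  hb0 : b ≠ 0
  hc0 : c ≠ 0
  ha1 : ‖a‖ < 1
  hb1 : ‖b‖ < 1
  hc1 : ‖c‖ < 1
  hu0 : q < ‖u‖
  hu1 : ‖u‖ < 1
  hau : ∀ n : ℤ, a * u ≠ (q : ℂ) ^ n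
  hbu : ∀ n : ℤ, b * u ≠ (q : ℂ) ^ n
  hcu : ∀ n : ℤ, c * u ≠ (q : ℂ) ^ n
  huu : ∀ n : ℤ, u ^ 2 ≠ (q : ℂ) ^ n

namespace IsGeneric

variable {q : ℝ} {a b c u : ℂ}

lemma q_ne_zero (H : IsGeneric q a b c u) : (q : ℂ) ≠ 0 := by exact_mod_cast H.hq0.ne'

lemma u_ne_zero (H : IsGeneric q a b c u) : u ≠ 0 :=
  norm_pos_iff.1 (H.hq0.trans H.hu0)

lemma mul_q_pow (H : IsGeneric q a b c u) (n : ℕ) : IsGeneric q (a * (q : ℂ) ^ n) b c u where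
  hq0 := H.hq0
  hq1 := H.hq1
  ha0 := mul_ne_zero H.ha0 (pow_ne_zero _ H.q_ne_zero)
  hb0 := H.hb0
  hc0 := H.hc0
  ha1 := by
    rw [norm_mul, norm_pow]
    exact mul_lt_one_of_nonneg_of_lt_one_left (norm_nonneg _) H.ha1
      (pow_le_one₀ (norm_nonneg _) (norm_ofReal_lt_one H.hq0 H.hq1).le)
  hb1 := H.hb1
  hc1 := H.hc1
  hu0 := H.hu0
  hu1 := H.hu1
  hau := fun m hm => H.hau (m - n) (by
    have := pow_ne_zero n H.q_ne_zero
    rw [zpow_sub₀ H.q_ne_zero, ← hm, zpow_natCast]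
    field_simp)
  hbu := H.hbu
  hcu := H.hcu
  huu := H.huu

end IsGeneric

lemma macdonaldMehtaIntegrand_eq (q : ℝ) (a b c u x : ℂ) :
    macdonaldMehtaIntegrand q a b c u x = qPoch q (x ^ 2) * qPoch q (1 / x ^ 2) /
      (qPoch q (a * x) * qPoch q (a / x) * (qPoch q (b * x) * qPoch q (b / x)) *
        (qPoch q (c * x) * qPoch q (c / x)) * (qTheta q (u * x) * qTheta q (u / x)) * x) := by
  simp only [macdonaldMehtaIntegrand, qPochs, qThetas, List.map_cons, List.map_nil,
    List.prod_cons, List.prod_nil, mul_one, mul_assoc]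

/-- The factor of the residue at `x = 1 / y` that stays bounded for small `y`. -/
noncomputable def residueFactor (q : ℝ) (a b c y : ℂ) : ℂ :=
  (1 - y ^ 2) * qPoch q (q * y / b) * qPoch q (q * y / c) /
    (qPoch q (a * y) * qPoch q (b * y) * qPoch q (c * y))

/-- The constant `(q; q)_∞² θ(bu, cu)`. -/
noncomputable def residueConst (q : ℝ) (b c u : ℂ) : ℂ :=
  qPoch q q ^ 2 * qTheta q (b * u) * qTheta q (c * u)

/-- Closed form of the residue of the integrand at `x = u q ^ (-k)`, `k ≥ 1`. -/
noncomputable def residueValue (q : ℝ) (a b c u : ℂ) (k : ℕ) : ℂ :=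
  (b * c) ^ (-(k : ℤ)) / qPoch q (a * u * (q : ℂ) ^ (-(k : ℤ))) *
    residueFactor q a b c ((q : ℂ) ^ k / u) / residueConst q b c u

/-- The integrand times `x - p`, for `p = u q ^ (-k)`, with the zero of the theta function at `p`
cancelled explicitly. -/
noncomputable def regularPart (q : ℝ) (a b c u : ℂ) (k : ℕ) (p x : ℂ) : ℂ :=
  qPoch q (x ^ 2) * qPoch q (1 / x ^ 2) * ((-(p / x)) ^ k * (q : ℂ) ^ k.choose 2) /
    (qPoch q (a * x) * qPoch q (a / x) * (qPoch q (b * x) * qPoch q (b / x)) *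
      (qPoch q (c * x) * qPoch q (c / x)) * (qTheta q (u * x) *
      (qPoch q (q * (p / x)) * qPoch q (q * (x / p)))))

section

variable {q : ℝ} {a b c u : ℂ}

lemma integrand_eq_regularPart_div (H : IsGeneric q a b c u) (k : ℕ) {p x : ℂ}
    (hp : p = u * (q : ℂ) ^ (-(k : ℤ))) (hx : x ≠ 0) :
    macdonaldMehtaIntegrand q a b c u x = regularPart q a b c u k p x / (x - p) := by
  have hqc := H.q_ne_zero
  have hqk := pow_ne_zero k hqc
  have hp0 : p ≠ 0 := hp ▸ mul_ne_zero H.u_ne_zero (zpow_ne_zero _ hqc)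
  have hpx : p / x ≠ 0 := div_ne_zero hp0 hx
  have hux : u / x = p / x * (q : ℂ) ^ (k : ℤ) := by
    rw [hp, zpow_neg, zpow_natCast]
    field_simp
  have hθ : qTheta q (u / x) * x * ((-(p / x)) ^ k * (q : ℂ) ^ k.choose 2) =
      qPoch q (q * (p / x)) * qPoch q (q * (x / p)) * (x - p) := by
    have e1 : p / x * (q : ℂ) = q * (p / x) := by ring
    have e2 : (q : ℂ) / (p / x) = q * (x / p) := by field_simp
    rw [hux, qTheta_mul_zpow H.hq0 H.hq1 hpx, qTheta_eq, qPoch_eq_mul H.hq0 H.hq1 (p / x), e1, e2,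
      triangle_natCast, zpow_neg, zpow_neg, zpow_natCast, zpow_natCast]
    have h1 := pow_ne_zero k (neg_ne_zero.2 hpx)
    have h2 := pow_ne_zero (k.choose 2) hqc
    generalize (-(p / x)) ^ k = A at *
    generalize (q : ℂ) ^ k.choose 2 = B at *
    field_simp
  have hne : (-(p / x)) ^ k * (q : ℂ) ^ k.choose 2 ≠ 0 :=
    mul_ne_zero (pow_ne_zero k (neg_ne_zero.2 hpx)) (pow_ne_zero _ hqc)
  rw [macdonaldMehtaIntegrand_eq, regularPart, div_div, ← mul_div_mul_right _ _ hne]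
  congr 1
  linear_combination (qPoch q (a * x) * qPoch q (a / x) * (qPoch q (b * x) * qPoch q (b / x)) *
      (qPoch q (c * x) * qPoch q (c / x)) * qTheta q (u * x)) * hθ

lemma mul_zpow_neg_ne (H : IsGeneric q a b c u) {x : ℂ} (hx : ∀ n : ℤ, x ≠ (q : ℂ) ^ n) (k : ℤ) :
    ∀ n : ℤ, x * (q : ℂ) ^ k ≠ (q : ℂ) ^ n := fun n hn => hx (n - k) (by
  rw [zpow_sub₀ H.q_ne_zero, ← hn, mul_div_cancel_right₀ _ (zpow_ne_zero _ H.q_ne_zero)])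

lemma norm_inv_pole_lt_one (H : IsGeneric q a b c u) {k : ℕ} (hk : 1 ≤ k) :
    ‖(q : ℂ) ^ k / u‖ < 1 := by
  rw [norm_div, norm_pow, Complex.norm_real, Real.norm_of_nonneg H.hq0.le,
    div_lt_one (H.hq0.trans H.hu0)]
  exact (pow_le_of_le_one H.hq0.le H.hq1.le (by omega)).trans_lt H.hu0

lemma norm_mul_lt_one {x y : ℂ} (hx : ‖x‖ < 1) (hy : ‖y‖ < 1) : ‖x * y‖ < 1 := by
  rw [norm_mul]
  exact mul_lt_one_of_nonneg_of_lt_one_left (norm_nonneg _) hx hy.le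

/-- The genericity of `u ^ 2` makes `θ(u p)` nonzero, so that the pole at `p` is simple. -/
lemma regularPart_den_ne_zero (H : IsGeneric q a b c u) {k : ℕ} (hk : 1 ≤ k) {p : ℂ}
    (hp : p = u * (q : ℂ) ^ (-(k : ℤ))) :
    (qPoch q (a * p) * qPoch q (a / p) * (qPoch q (b * p) * qPoch q (b / p)) *
      (qPoch q (c * p) * qPoch q (c / p)) * (qTheta q (u * p) *
      (qPoch q (q * (p / p)) * qPoch q (q * (p / p))))) ≠ 0 := by
  have hqc := H.q_ne_zero
  have hu := H.u_ne_zero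
  have hy := norm_inv_pole_lt_one H hk
  have hp0 : p ≠ 0 := hp ▸ mul_ne_zero hu (zpow_ne_zero _ hqc)
  have hdiv : ∀ s : ℂ, ‖s‖ < 1 → qPoch q (s / p) ≠ 0 := fun s hs => by
    have e : s / p = s * ((q : ℂ) ^ k / u) := by
      rw [hp, zpow_neg, zpow_natCast]
      field_simp
    rw [e]
    exact qPoch_ne_zero_of_norm_lt_one H.hq0 H.hq1 (norm_mul_lt_one hs hy)
  have hmul : ∀ s : ℂ, (∀ n : ℤ, s * u ≠ (q : ℂ) ^ n) → ∀ n : ℤ, s * p ≠ (q : ℂ) ^ n :=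
    fun s hs => by
      rw [hp, ← mul_assoc]
      exact mul_zpow_neg_ne H hs _
  have hqq : qPoch q (q * (p / p)) ≠ 0 := by
    rw [div_self hp0, mul_one]
    exact qPoch_ne_zero_of_norm_lt_one H.hq0 H.hq1 (norm_ofReal_lt_one H.hq0 H.hq1)
  have hne := fun s hs => qPoch_ne_zero_of_zpow H.hq0 H.hq1 (hmul s hs)
  have hθ := qTheta_ne_zero H.hq0 H.hq1 (mul_ne_zero hu hp0)
    (hmul u fun n => by rw [← pow_two]; exact H.huu n)
  simp only [ne_eq, mul_eq_zero, not_or]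
  exact ⟨⟨⟨⟨hne a H.hau, hdiv a H.ha1⟩, hne b H.hbu, hdiv b H.hb1⟩, hne c H.hcu, hdiv c H.hc1⟩,
    hθ, hqq, hqq⟩

lemma differentiableAt_regularPart (H : IsGeneric q a b c u) {k : ℕ} (hk : 1 ≤ k) {p : ℂ}
    (hp : p = u * (q : ℂ) ^ (-(k : ℤ))) :
    ∀ᶠ x in 𝓝 p, DifferentiableAt ℂ (regularPart q a b c u k p) x := by
  have hd := differentiable_qPoch H.hq0 H.hq1
  have hu := H.u_ne_zero
  have hp0 : p ≠ 0 := hp ▸ mul_ne_zero hu (zpow_ne_zero _ H.q_ne_zero)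
  have hden : ∀ x : ℂ, x ≠ 0 → DifferentiableAt ℂ (fun x =>
      (qPoch q (a * x) * qPoch q (a / x) * (qPoch q (b * x) * qPoch q (b / x)) *
      (qPoch q (c * x) * qPoch q (c / x)) * (qTheta q (u * x) *
      (qPoch q (q * (p / x)) * qPoch q (q * (x / p)))))) x := fun x hx => by
    have hux : u * x ≠ 0 := mul_ne_zero hu hx
    simp only [qTheta_eq]
    fun_prop (disch := assumption)
  filter_upwards [eventually_ne_nhds hp0,
    (hden p hp0).continuousAt.eventually_ne (regularPart_den_ne_zero H hk hp)] with x hx hx'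
  refine DifferentiableAt.fun_div ?_ (hden x hx) hx'
  have hx2 : x ^ 2 ≠ 0 := pow_ne_zero _ hx
  fun_prop (disch := assumption)

lemma regularPart_self (H : IsGeneric q a b c u) {k : ℕ} (hk : 1 ≤ k) {p : ℂ}
    (hp : p = u * (q : ℂ) ^ (-(k : ℤ))) :
    regularPart q a b c u k p p = residueValue q a b c u k := by
  have hqc := H.q_ne_zero
  have hu := H.u_ne_zero
  have hp0 : p ≠ 0 := hp ▸ mul_ne_zero hu (zpow_ne_zero _ hqc)
  have hden := regularPart_den_ne_zero H hk hp
  obtain ⟨y, hy⟩ : ∃ y, y = (q : ℂ) ^ k / u := ⟨_, rfl⟩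
  have hqk := pow_ne_zero k hqc
  have hpy : p = y⁻¹ := by rw [hp, hy, zpow_neg, zpow_natCast]; field_simp
  have hy0 : y ≠ 0 := by rintro rfl; simp [hpy] at hp0
  -- the theta functions at `p` in terms of those at `u`
  have hT : ∀ s : ℂ, s ≠ 0 → qTheta q (s * p) =
      (-(s * u)) ^ k * (q : ℂ) ^ (-triangle (-(k : ℤ))) * qTheta q (s * u) := fun s hs => by
    rw [hp, ← mul_assoc, qTheta_mul_zpow H.hq0 H.hq1 (mul_ne_zero hs hu), neg_neg, zpow_natCast]
  have hT2 : qTheta q (p ^ 2) =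
      (u ^ 2) ^ (2 * k) * (q : ℂ) ^ (-triangle (-(2 * k : ℤ))) * qTheta q (u * u) := by
    have e : p ^ 2 = u * u * (q : ℂ) ^ (-(2 * k : ℤ)) := by
      rw [hp, mul_pow, ← zpow_natCast ((q : ℂ) ^ _), ← zpow_mul]
      push_cast
      ring_nf
    rw [e, qTheta_mul_zpow H.hq0 H.hq1 (mul_ne_zero hu hu), neg_neg]
    have e2 : ((2 : ℤ) * (k : ℤ)) = ((2 * k : ℕ) : ℤ) := by push_cast; ring
    rw [e2, zpow_natCast, Even.neg_pow ⟨k, by ring⟩]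
    ring
  -- all powers of `q` that are quadratic in `k` cancel in the residue
  have hexp : (q : ℂ) ^ (-triangle (-(2 * k : ℤ))) * (q : ℂ) ^ k.choose 2 =
      ((q : ℂ) ^ (-triangle (-(k : ℤ)))) ^ 3 := by
    rw [← zpow_natCast _ (k.choose 2), ← triangle_natCast, ← zpow_add₀ hqc, ← zpow_natCast,
      ← zpow_mul]
    congr 1
    have h1 := two_mul_triangle (-(2 * k : ℤ))
    have h2 := two_mul_triangle (-(k : ℤ))
    have h3 := two_mul_triangle (k : ℤ)
    push_cast
    linarith
  have hnum : qPoch q (p ^ 2) * qPoch q (1 / p ^ 2) = qTheta q (p ^ 2) * (1 - y ^ 2) := by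
    have e1 : 1 / p ^ 2 * (q : ℂ) = q / p ^ 2 := by ring
    have e2 : 1 / p ^ 2 = y ^ 2 := by rw [hpy]; field_simp
    rw [qTheta_eq, qPoch_eq_mul H.hq0 H.hq1 (1 / p ^ 2), e1, e2]
    ring
  have hB : ∀ s : ℂ, s ≠ 0 → qPoch q (s * p) * qPoch q (q * y / s) =
      (-(s * u)) ^ k * (q : ℂ) ^ (-triangle (-(k : ℤ))) * qTheta q (s * u) := fun s hs => by
    have e : (q : ℂ) / (s * p) = q * y / s := by rw [hpy]; field_simp
    rw [← hT s hs, qTheta_eq, e]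
  have hb := hB b H.hb0
  have hc := hB c H.hc0
  have hθ := hT u hu
  have hdy : ∀ s : ℂ, s / p = s * y := fun s => by rw [hpy, div_inv_eq_mul]
  have hpp : p / p = 1 := div_self hp0
  have hap : a * u * (q : ℂ) ^ (-(k : ℤ)) = a * p := by rw [hp, mul_assoc]
  have hpow : (u ^ 2) ^ (2 * k) * (-1) ^ k * (b * c) ^ k =
      (-(u * u)) ^ k * (-(b * u)) ^ k * (-(c * u)) ^ k := by
    rw [pow_mul, ← mul_pow, ← mul_pow, ← mul_pow, ← mul_pow]
    ring
  have hbk := pow_ne_zero k (mul_ne_zero H.hb0 H.hc0)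
  have hθb := qTheta_ne_zero H.hq0 H.hq1 (mul_ne_zero H.hb0 hu) H.hbu
  have hθc := qTheta_ne_zero H.hq0 H.hq1 (mul_ne_zero H.hc0 hu) H.hcu
  have hqq := qPoch_ne_zero_of_norm_lt_one H.hq0 H.hq1 (norm_ofReal_lt_one H.hq0 H.hq1)
  rw [hpp, hθ, hdy, hdy, hdy, mul_one] at hden
  rw [regularPart, residueValue, residueFactor, residueConst, hnum, hT2, hpp, hθ, ← hy, hap, hdy,
    hdy, hdy, mul_one, zpow_neg (b * c), zpow_natCast (b * c)]
  -- what remains is a rational identity in independent variables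
  generalize (q : ℂ) ^ (-triangle (-(2 * k : ℤ))) = E₂ at *
  generalize (q : ℂ) ^ (-triangle (-(k : ℤ))) = E at *
  generalize (q : ℂ) ^ k.choose 2 = Q at *
  generalize (b * c) ^ k = K at *
  generalize (-(u * u)) ^ k = V at *
  generalize (-(b * u)) ^ k = Vb at *
  generalize (-(c * u)) ^ k = Vc at *
  generalize (u ^ 2) ^ (2 * k) = U at *
  generalize qPoch q (a * p) = A at *
  generalize qPoch q (b * p) = B at *
  generalize qPoch q (c * p) = C at *
  generalize qPoch q (q * y / b) = B' at *
  generalize qPoch q (q * y / c) = C' at *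
  generalize qPoch q (a * y) = ay at *
  generalize qPoch q (b * y) = bY at *
  generalize qPoch q (c * y) = cy at *
  generalize qPoch q (q : ℂ) = P at *
  generalize qTheta q (b * u) = θb at *
  generalize qTheta q (c * u) = θc at *
  generalize qTheta q (u * u) = θu at *
  have hd := hden
  simp only [ne_eq, mul_eq_zero, not_or] at hd
  obtain ⟨⟨⟨⟨hA, hay⟩, hB0, hby⟩, hC0, hcy⟩, -⟩ := hd
  have hR : K⁻¹ / A * ((1 - y ^ 2) * B' * C' / (ay * bY * cy)) / (P ^ 2 * θb * θc) =
      (1 - y ^ 2) * B' * C' / (K * A * (ay * bY * cy) * (P ^ 2 * θb * θc)) := by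
    field_simp
  rw [hR, div_eq_div_iff hden (by simp [*])]
  linear_combination (1 - y ^ 2) * A * ay * bY * cy * P ^ 2 * θu *
    (U * (-1) ^ k * K * θb * θc * hexp + θb * θc * E ^ 3 * hpow -
      V * E * (C * C' * hb + Vb * E * θb * hc))

lemma complexResidue_integrand (H : IsGeneric q a b c u) {k : ℕ} (hk : 1 ≤ k) :
    complexResidue (macdonaldMehtaIntegrand q a b c u) (u * (q : ℂ) ^ (-(k : ℤ))) =
        residueValue q a b c u k ∧
      MeromorphicAt (macdonaldMehtaIntegrand q a b c u) (u * (q : ℂ) ^ (-(k : ℤ))) := by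
  have hp0 : u * (q : ℂ) ^ (-(k : ℤ)) ≠ 0 := mul_ne_zero H.u_ne_zero (zpow_ne_zero _ H.q_ne_zero)
  rw [← regularPart_self H hk rfl]
  refine complexResidue_eq_of_simple_pole (differentiableAt_regularPart H hk rfl) ?_
  filter_upwards [nhdsWithin_le_nhds (eventually_ne_nhds hp0)] with x hx
  exact integrand_eq_regularPart_div H k rfl hx

end

/-! ### The contour integral of a `q`-difference -/

/-- The function `h(x) = (q x², 1 / x²; q)_∞ / ((aqx, a/x, bqx, b/x, cqx, c/x; q)_∞ θ(ux, u/x))`.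
It is anti-invariant under `x ↦ 1 / (q x)`. -/
noncomputable def antiInvariant (q : ℝ) (a b c u x : ℂ) : ℂ :=
  qPoch q (q * x ^ 2) * qPoch q (1 / x ^ 2) /
    (qPoch q (a * q * x) * qPoch q (a / x) * (qPoch q (b * q * x) * qPoch q (b / x)) *
      (qPoch q (c * q * x) * qPoch q (c / x)) * (qTheta q (u * x) * qTheta q (u / x)))

/-- The function `h(x) / x` times `(x - u / q) (x - 1 / u)`, with the zeros of the theta functions
at `u / q` and `1 / u` cancelled explicitly; here `h` is `antiInvariant`. -/
noncomputable def annulusPart (q : ℝ) (a b c u x : ℂ) : ℂ :=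
  qPoch q (q * x ^ 2) * qPoch q (1 / x ^ 2) /
    (qPoch q (a * q * x) * qPoch q (a / x) * (qPoch q (b * q * x) * qPoch q (b / x)) *
      (qPoch q (c * q * x) * qPoch q (c / x)) *
      (qPoch q (u * q * x) * qPoch q (u / x) * (qPoch q (q / u / x) * qPoch q (q / u * q * x))) *
      q * x)

section

variable {q : ℝ} {a b c u : ℂ}

lemma antiInvariant_div_eq (H : IsGeneric q a b c u) {x : ℂ} (hx : x ≠ 0) :
    antiInvariant q a b c u x / x = annulusPart q a b c u x / ((x - u / q) * (x - 1 / u)) := by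
  have hqc := H.q_ne_zero
  have hu := H.u_ne_zero
  have e1 : u * x * q = u * q * x := by ring
  have e2 : (q : ℂ) / (u * x) = q / u / x := by field_simp
  have e3 : (q : ℂ) / (u / x) = q / u * x := by field_simp
  have e4 : q / u * x * q = q / u * q * x := by ring
  rw [antiInvariant, annulusPart, div_div, div_div, qTheta_eq, qTheta_eq,
    qPoch_eq_mul H.hq0 H.hq1 (u * x), e1, e2, e3, qPoch_eq_mul H.hq0 H.hq1 (q / u * x), e4]
  congr 1
  field_simp
  ring

lemma annulusPart_inv (H : IsGeneric q a b c u) {x : ℂ} (hx : x ≠ 0) :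
    annulusPart q a b c u (1 / (q * x)) = -annulusPart q a b c u x := by
  have hqc := H.q_ne_zero
  have e1 : ∀ s : ℂ, s * q * (1 / (q * x)) = s / x := fun s => by field_simp
  have e2 : ∀ s : ℂ, s / (1 / (q * x)) = s * q * x := fun s => by field_simp
  have e3 : (q : ℂ) * (1 / (q * x)) ^ 2 = 1 / (q * x ^ 2) := by field_simp
  have e4 : 1 / (1 / (q * x)) ^ 2 = q * x ^ 2 * q := by field_simp
  have e5 : 1 / (q * x ^ 2) * (q : ℂ) = 1 / x ^ 2 := by field_simp
  have key : qPoch q (1 / (q * x ^ 2)) * qPoch q (q * x ^ 2 * q) * (q * x ^ 2) =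
      -(qPoch q (q * x ^ 2) * qPoch q (1 / x ^ 2)) := by
    rw [qPoch_eq_mul H.hq0 H.hq1 (1 / (q * x ^ 2)), e5, qPoch_eq_mul H.hq0 H.hq1 (q * x ^ 2)]
    field_simp
    ring
  rw [annulusPart, annulusPart, e3, e4]
  simp only [e1, e2]
  rw [← neg_div, ← key, ← mul_div_mul_right _ _ (mul_ne_zero hqc (pow_ne_zero 2 hx))]
  congr 1
  field_simp

lemma antiInvariant_inv (H : IsGeneric q a b c u) {x : ℂ} (hx : x ≠ 0) :
    antiInvariant q a b c u (1 / (q * x)) = -antiInvariant q a b c u x := by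
  have hqc := H.q_ne_zero
  have hu := H.u_ne_zero
  have hx' : 1 / (q * x) ≠ 0 := one_div_ne_zero (mul_ne_zero hqc hx)
  have h1 := antiInvariant_div_eq H hx
  have h2 := antiInvariant_div_eq H hx'
  rw [div_eq_iff hx] at h1
  rw [div_eq_iff hx', annulusPart_inv H hx] at h2
  rw [h1, h2]
  have e : (1 / (q * x) - u / q) * (1 / (q * x) - 1 / u) =
      (x - u / q) * (x - 1 / u) / (q * x ^ 2) := by
    field_simp
    ring
  rw [e]
  generalize (x - u / q) * (x - 1 / u) = D
  rw [div_div_eq_mul_div]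
  field_simp

lemma annulusPart_differentiableAt (H : IsGeneric q a b c u) {x : ℂ} (h1 : 1 ≤ ‖x‖)
    (h2 : ‖x‖ ≤ q⁻¹) : DifferentiableAt ℂ (annulusPart q a b c u) x := by
  have hd := differentiable_qPoch H.hq0 H.hq1
  have hqc := H.q_ne_zero
  have hx : x ≠ 0 := norm_pos_iff.1 (one_pos.trans_le h1)
  have hx2 : x ^ 2 ≠ 0 := pow_ne_zero 2 hx
  have hq1 : ∀ s : ℂ, ‖s‖ < 1 → qPoch q (s * q * x) ≠ 0 := fun s hs => by
    refine qPoch_ne_zero_of_norm_lt_one H.hq0 H.hq1 ?_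
    rw [mul_assoc, norm_mul, norm_mul, Complex.norm_real, Real.norm_of_nonneg H.hq0.le]
    refine mul_lt_one_of_nonneg_of_lt_one_left (norm_nonneg _) hs ?_
    calc q * ‖x‖ ≤ q * q⁻¹ := mul_le_mul_of_nonneg_left h2 H.hq0.le
      _ = 1 := mul_inv_cancel₀ H.hq0.ne'
  have hq2 : ∀ s : ℂ, ‖s‖ < 1 → qPoch q (s / x) ≠ 0 := fun s hs => by
    refine qPoch_ne_zero_of_norm_lt_one H.hq0 H.hq1 ?_
    rw [norm_div]
    exact (div_le_self (norm_nonneg _) h1).trans_lt hs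
  have hqu : ‖(q : ℂ) / u‖ < 1 := by simpa using norm_inv_pole_lt_one H le_rfl
  have hden := mul_ne_zero (mul_ne_zero (mul_ne_zero (mul_ne_zero (mul_ne_zero
    (mul_ne_zero (hq1 a H.ha1) (hq2 a H.ha1)) (mul_ne_zero (hq1 b H.hb1) (hq2 b H.hb1)))
    (mul_ne_zero (hq1 c H.hc1) (hq2 c H.hc1)))
    (mul_ne_zero (mul_ne_zero (hq1 u H.hu1) (hq2 u H.hu1))
      (mul_ne_zero (hq2 _ hqu) (hq1 _ hqu)))) hqc) hx
  unfold annulusPart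
  fun_prop (disch := assumption)

/-- The term `-Res_{x = u q ^ (-k - 1)} h(x) / x` of the telescoping series of residues, where `h`
is `antiInvariant`. -/
noncomputable def telescopingTerm (q : ℝ) (a b c u : ℂ) (k : ℕ) : ℂ :=
  (b * c) ^ (-(k : ℤ)) / qPoch q (a * u * (q : ℂ) ^ (-(k : ℤ))) *
    (qPoch q (q * ((q : ℂ) ^ k / u) / b) * qPoch q (q * ((q : ℂ) ^ k / u) / c) /
      (qPoch q (a * q * ((q : ℂ) ^ k / u)) * qPoch q (b * q * ((q : ℂ) ^ k / u)) *
        qPoch q (c * q * ((q : ℂ) ^ k / u)))) / residueConst q b c u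

lemma annulusPart_pole (H : IsGeneric q a b c u) :
    annulusPart q a b c u (u / q) / (u / q - 1 / u) = -telescopingTerm q a b c u 0 := by
  have hqc := H.q_ne_zero
  have hu := H.u_ne_zero
  have hu2 : u ^ 2 - q ≠ 0 := sub_ne_zero.2 (by simpa using H.huu 1)
  have hqu : ‖(q : ℂ) / u‖ < 1 := by simpa using norm_inv_pole_lt_one H le_rfl
  have hp : ∀ s : ℂ, s * q * (u / q) = s * u := fun s => by field_simp
  have hd : ∀ s : ℂ, s / (u / q) = s * q / u := fun s => by field_simp
  have e1 : (q : ℂ) * (u / q) ^ 2 = u ^ 2 / q := by field_simp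
  have e2 : 1 / (u / q) ^ 2 = (q : ℂ) ^ 2 / u ^ 2 := by field_simp
  have e3 : u ^ 2 / q * (q : ℂ) = u ^ 2 := by field_simp
  have e4 : (q : ℂ) / u * q / u = (q : ℂ) ^ 2 / u ^ 2 := by field_simp
  have e5 : u * q / u = (q : ℂ) := by field_simp
  have e6 : (q : ℂ) / u * u = (q : ℂ) := by field_simp
  have e7 : ∀ s : ℂ, s * q * (1 / u) = s * q / u := fun s => by field_simp
  have e8 : ∀ s : ℂ, (q : ℂ) * (1 / u) / s = q / (s * u) := fun s => by
    rw [mul_one_div, div_div, mul_comm]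
  have hna := qPoch_ne_zero_of_zpow H.hq0 H.hq1 H.hau
  have hnb := qTheta_ne_zero H.hq0 H.hq1 (mul_ne_zero H.hb0 hu) H.hbu
  have hnc := qTheta_ne_zero H.hq0 H.hq1 (mul_ne_zero H.hc0 hu) H.hcu
  rw [qTheta_eq] at hnb hnc
  obtain ⟨hnb1, hnb2⟩ := mul_ne_zero_iff.1 hnb
  obtain ⟨hnc1, hnc2⟩ := mul_ne_zero_iff.1 hnc
  have hlt : ∀ s : ℂ, ‖s‖ < 1 → qPoch q (s * q / u) ≠ 0 := fun s hs => by
    rw [mul_div_assoc]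
    exact qPoch_ne_zero_of_norm_lt_one H.hq0 H.hq1 (norm_mul_lt_one hs hqu)
  have ha := hlt a H.ha1
  have hb := hlt b H.hb1
  have hc := hlt c H.hc1
  have hqq := qPoch_ne_zero_of_norm_lt_one H.hq0 H.hq1 (norm_ofReal_lt_one H.hq0 H.hq1)
  have hu22 : qPoch q (u ^ 2) ≠ 0 := qPoch_ne_zero_of_zpow H.hq0 H.hq1 H.huu
  have hqu2 : qPoch q ((q : ℂ) ^ 2 / u ^ 2) ≠ 0 := by
    rw [← e4]; exact hlt _ hqu
  have huu' : u / q - 1 / u = (u ^ 2 - q) / (q * u) := by field_simp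
  have e9 : 1 - u ^ 2 / q = -(u ^ 2 - q) / q := by field_simp; ring
  rw [annulusPart, telescopingTerm, residueConst, qTheta_eq, qTheta_eq, e1, e2,
    qPoch_eq_mul H.hq0 H.hq1 (u ^ 2 / q), e3, e9, huu']
  simp only [hp, hd, e4, e5, e6, pow_zero, e7, e8, Nat.cast_zero, neg_zero, zpow_zero, mul_one]
  rw [← pow_two u]
  clear e1 e2 e3 e4 e5 e6 e7 e8 e9 hp hd hlt hnb hnc huu'
  generalize u ^ 2 - (q : ℂ) = D at *
  generalize qPoch q (a * u) = A at *
  generalize qPoch q (b * u) = B at *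
  generalize qPoch q (c * u) = C at *
  generalize qPoch q (q / (b * u)) = B' at *
  generalize qPoch q (q / (c * u)) = C' at *
  generalize qPoch q (a * q / u) = Aq at *
  generalize qPoch q (b * q / u) = Bq at *
  generalize qPoch q (c * q / u) = Cq at *
  generalize qPoch q (q : ℂ) = P at *
  generalize qPoch q ((q : ℂ) ^ 2 / u ^ 2) = U at *
  generalize qPoch q (u ^ 2) = V at *
  field_simp

/-- The integral of `h(x) / x` over the unit circle. Inversion turns it into minus the integral
over `|x| = 1 / q`, and the two simple poles `u / q`, `1 / u` in between contribute equally. -/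
lemma circleIntegral_antiInvariant (H : IsGeneric q a b c u) :
    (∮ x in C(0, 1), antiInvariant q a b c u x / x) =
      2 * Real.pi * Complex.I * telescopingTerm q a b c u 0 := by
  have hqc := H.q_ne_zero
  have hu := H.u_ne_zero
  have hq1 : (1 : ℝ) < q⁻¹ := (one_lt_inv₀ H.hq0).2 H.hq1
  have hupos := H.hq0.trans H.hu0
  have hcongr : ∀ R : ℝ, 0 < R → (∮ x in C(0, R), antiInvariant q a b c u x / x) =
      ∮ x in C(0, R), annulusPart q a b c u x / ((x - u / q) * (x - 1 / u)) := fun R hR =>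
    circleIntegral.integral_congr hR.le fun x hx =>
      antiInvariant_div_eq H (Metric.ne_of_mem_sphere hx hR.ne')
  have hinv : (∮ x in C(0, q⁻¹), antiInvariant q a b c u x / x) =
      -∮ x in C(0, 1), antiInvariant q a b c u x / x := by
    have h := circleIntegral_comp_inv_div (antiInvariant q a b c u) (t := q⁻¹) one_ne_zero
      (inv_ne_zero H.hq0.ne')
    rw [div_one] at h
    rw [← h, ← neg_one_mul, ← circleIntegral.integral_const_mul]
    refine circleIntegral.integral_congr zero_le_one fun x hx => ?_
    have hx0 : x ≠ 0 := Metric.ne_of_mem_sphere hx one_ne_zero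
    have e : ((q⁻¹ : ℝ) : ℂ) / x = 1 / (q * x) := by push_cast; field_simp
    simp only [e, antiInvariant_inv H hx0]
    ring
  have h1 : ‖u / (q : ℂ)‖ = ‖u‖ / q := by
    rw [norm_div, Complex.norm_real, Real.norm_of_nonneg H.hq0.le]
  have h2 : ‖1 / u‖ = ‖u‖⁻¹ := by rw [norm_div, norm_one, one_div]
  have hne : u / q ≠ 1 / u := fun h => H.huu 1 (by
    field_simp at h
    simpa using h)
  have h := circleIntegral_div_sub_mul_sub_annulus (N := annulusPart q a b c u) (r := 1)
    (R := q⁻¹) (p := u / q) (p' := 1 / u) one_pos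
    (by rw [h1, one_lt_div H.hq0]; exact H.hu0)
    (by rw [h1, div_eq_mul_inv]; exact mul_lt_of_lt_one_left (inv_pos.2 H.hq0) H.hu1)
    (by rw [h2]; exact (one_lt_inv₀ hupos).2 H.hu1)
    (by rw [h2]; exact (inv_lt_inv₀ hupos H.hq0).2 H.hu0)
    hne (fun x => annulusPart_differentiableAt H)
  rw [← hcongr 1 one_pos, ← hcongr q⁻¹ (inv_pos.2 H.hq0), hinv] at h
  -- `x ↦ 1 / (q x)` exchanges the two poles
  have hM : annulusPart q a b c u (1 / u) = -annulusPart q a b c u (u / q) := by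
    rw [← annulusPart_inv H (div_ne_zero hu hqc), mul_div_cancel₀ _ hqc]
  rw [hM, sub_neg_eq_add, ← two_mul, mul_div_assoc, annulusPart_pole H] at h
  linear_combination (-1 / 2 : ℂ) * h

/-- On the unit circle all the denominators are nonzero. -/
lemma integrand_den_ne_zero (H : IsGeneric q a b c u) {x : ℂ} (hx : ‖x‖ = 1) :
    qPoch q (a * x) * qPoch q (a / x) * (qPoch q (b * x) * qPoch q (b / x)) *
        (qPoch q (c * x) * qPoch q (c / x)) * (qTheta q (u * x) * qTheta q (u / x)) * x ≠ 0 := by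
  have hx0 : x ≠ 0 := norm_ne_zero_iff.1 (by rw [hx]; exact one_ne_zero)
  have hP : ∀ s : ℂ, ‖s‖ < 1 → qPoch q (s * x) * qPoch q (s / x) ≠ 0 := fun s hs =>
    mul_ne_zero (qPoch_ne_zero_of_norm_lt_one H.hq0 H.hq1 (by rwa [norm_mul, hx, mul_one]))
      (qPoch_ne_zero_of_norm_lt_one H.hq0 H.hq1 (by rwa [norm_div, hx, div_one]))
  have hT : ∀ s : ℂ, ‖s‖ = ‖u‖ → qTheta q s ≠ 0 := fun s hs => by
    rw [qTheta_eq]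
    refine mul_ne_zero (qPoch_ne_zero_of_norm_lt_one H.hq0 H.hq1 (hs ▸ H.hu1))
      (qPoch_ne_zero_of_norm_lt_one H.hq0 H.hq1 ?_)
    rw [norm_div, hs, Complex.norm_real, Real.norm_of_nonneg H.hq0.le]
    exact (div_lt_one (H.hq0.trans H.hu0)).2 H.hu0
  exact mul_ne_zero (mul_ne_zero (mul_ne_zero (mul_ne_zero (hP a H.ha1) (hP b H.hb1))
    (hP c H.hc1)) (mul_ne_zero (hT _ (by rw [norm_mul, hx, mul_one]))
      (hT _ (by rw [norm_div, hx, div_one])))) hx0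

lemma continuousOn_integrand (H : IsGeneric q a b c u) :
    ContinuousOn (macdonaldMehtaIntegrand q a b c u) (Metric.sphere 0 1) := by
  intro x hx
  have hx1 : ‖x‖ = 1 := by simpa using hx
  have hd := differentiable_qPoch H.hq0 H.hq1
  have hx0 : x ≠ 0 := norm_ne_zero_iff.1 (by rw [hx1]; exact one_ne_zero)
  have hx2 : x ^ 2 ≠ 0 := pow_ne_zero 2 hx0
  have hux : u * x ≠ 0 := mul_ne_zero H.u_ne_zero hx0
  have hux' : u / x ≠ 0 := div_ne_zero H.u_ne_zero hx0
  have hden := integrand_den_ne_zero H hx1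
  have he : macdonaldMehtaIntegrand q a b c u = fun x => _ :=
    funext (macdonaldMehtaIntegrand_eq q a b c u)
  rw [he]
  simp only [qTheta_eq] at hden ⊢
  refine (DifferentiableAt.continuousAt (𝕜 := ℂ) ?_).continuousWithinAt
  fun_prop (disch := assumption)

lemma circleIntegrable_integrand (H : IsGeneric q a b c u) :
    CircleIntegrable (macdonaldMehtaIntegrand q a b c u) 0 1 :=
  (continuousOn_integrand H).circleIntegrable zero_le_one

lemma integrand_mul_q (H : IsGeneric q a b c u) {x : ℂ} (hx : ‖x‖ = 1) :
    macdonaldMehtaIntegrand q (a * q) b c u x =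
      (1 - a * x) * (1 - a / x) * macdonaldMehtaIntegrand q a b c u x := by
  have hden := integrand_den_ne_zero H hx
  have e1 : a * x * q = a * q * x := by ring
  have e2 : a / x * q = a * q / x := by ring
  rw [macdonaldMehtaIntegrand_eq, macdonaldMehtaIntegrand_eq]
  rw [qPoch_eq_mul H.hq0 H.hq1 (a * x), qPoch_eq_mul H.hq0 H.hq1 (a / x), e1, e2] at hden ⊢
  simp only [ne_eq, mul_eq_zero, not_or] at hden
  obtain ⟨⟨⟨⟨⟨⟨h1, h2⟩, h3, h4⟩, h5, h6⟩, h7, h8⟩, h9, h10⟩, h11⟩ := hden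
  generalize 1 - a * x = s at *
  generalize 1 - a / x = t at *
  field_simp

/-- The weight times `(1 - ab)(1 - ac) - bc (1 - ax)(1 - a/x)` is the `q`-difference
`h(x) + h(1/x) = h(x) - h(x/q)`. -/
lemma integrand_eq_antiInvariant_add (H : IsGeneric q a b c u) {x : ℂ} (hx : ‖x‖ = 1) :
    (1 - a * b) * (1 - a * c) * macdonaldMehtaIntegrand q a b c u x -
        b * c * macdonaldMehtaIntegrand q (a * q) b c u x =
      antiInvariant q a b c u x / x + antiInvariant q a b c u (1 / x) / x := by
  have hden := integrand_den_ne_zero H hx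
  have hx0 : x ≠ 0 := norm_ne_zero_iff.1 (by rw [hx]; exact one_ne_zero)
  rw [integrand_mul_q H hx, macdonaldMehtaIntegrand_eq, antiInvariant, antiInvariant]
  have e1 : ∀ s : ℂ, s * x * q = s * q * x := fun s => by ring
  have e2 : ∀ s : ℂ, s / x * q = s * q / x := fun s => by ring
  have e3 : ∀ s : ℂ, s * (1 / x) = s / x := fun s => by ring
  have e4 : ∀ s : ℂ, s / (1 / x) = s * x := fun s => by rw [div_div_eq_mul_div, div_one]
  have e5 : x ^ 2 * q = q * x ^ 2 := by ring
  have e6 : 1 / x ^ 2 * q = q / x ^ 2 := by ring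
  have e7 : 1 / (1 / x) ^ 2 = x ^ 2 := by field_simp
  have e8 : (q : ℂ) * (1 / x) ^ 2 = q / x ^ 2 := by field_simp
  -- the polynomial identity left after removing the common infinite products; the factors
  -- `1 - x ^ 2` and `1 - 1 / x ^ 2` are not divided by, as they vanish at `x = ± 1`
  have hpoly : (1 - x ^ 2) * (1 - 1 / x ^ 2) * ((1 - a * b) * (1 - a * c) -
      b * c * ((1 - a * x) * (1 - a / x))) =
      (1 - 1 / x ^ 2) * ((1 - a * x) * (1 - b * x) * (1 - c * x)) +
      (1 - x ^ 2) * ((1 - a / x) * (1 - b / x) * (1 - c / x)) := by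
    field_simp
    ring
  have hP := fun s : ℂ => qPoch_eq_mul H.hq0 H.hq1 (s * x)
  have hP' := fun s : ℂ => qPoch_eq_mul H.hq0 H.hq1 (s / x)
  simp only [e1] at hP
  simp only [e2] at hP'
  simp only [e3, e4, e7, e8]
  rw [qPoch_eq_mul H.hq0 H.hq1 (x ^ 2), qPoch_eq_mul H.hq0 H.hq1 (1 / x ^ 2), e5, e6]
  rw [hP a, hP b, hP c, hP' a, hP' b, hP' c] at hden ⊢
  clear e1 e2 e3 e4 e5 e6 e7 e8 hP hP'
  generalize qPoch q (a * q * x) = A at *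
  generalize qPoch q (b * q * x) = B at *
  generalize qPoch q (c * q * x) = C at *
  generalize qPoch q (a * q / x) = A' at *
  generalize qPoch q (b * q / x) = B' at *
  generalize qPoch q (c * q / x) = C' at *
  generalize qTheta q (u * x) = T at *
  generalize qTheta q (u / x) = T' at *
  generalize qPoch q (q * x ^ 2) = Q at *
  generalize qPoch q (q / x ^ 2) = Q' at *
  simp only [ne_eq, mul_eq_zero, not_or] at hden
  obtain ⟨⟨⟨⟨⟨⟨a1, hA⟩, a2, hA'⟩, ⟨b1, hB⟩, b2, hB'⟩, ⟨c1, hC⟩, c2, hC'⟩, hT, hT'⟩, -⟩ := hden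
  generalize 1 - a * x = s₁ at *
  generalize 1 - b * x = s₂ at *
  generalize 1 - c * x = s₃ at *
  generalize 1 - a / x = t₁ at *
  generalize 1 - b / x = t₂ at *
  generalize 1 - c / x = t₃ at *
  generalize 1 - x ^ 2 = v at *
  generalize 1 - 1 / x ^ 2 = v' at *
  field_simp
  linear_combination Q * Q' * hpoly

/-- The contour integral of the `q`-difference `h(x) - h(x/q)`. -/
lemma circleIntegral_recurrence (H : IsGeneric q a b c u) :
    (1 - a * b) * (1 - a * c) * (∮ x in C(0, 1), macdonaldMehtaIntegrand q a b c u x) -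
        b * c * (∮ x in C(0, 1), macdonaldMehtaIntegrand q (a * q) b c u x) =
      4 * Real.pi * Complex.I * telescopingTerm q a b c u 0 := by
  have H' : IsGeneric q (a * q) b c u := by simpa using H.mul_q_pow 1
  have hinv := circleIntegral_comp_inv_div (antiInvariant q a b c u) (t := 1) one_ne_zero
    one_ne_zero
  rw [div_one, Complex.ofReal_one] at hinv
  have i3 : CircleIntegrable (fun x => antiInvariant q a b c u x / x) 0 1 := by
    refine ContinuousOn.circleIntegrable zero_le_one (ContinuousOn.congr (f := fun x =>
      annulusPart q a b c u x / ((x - u / q) * (x - 1 / u))) (fun x hx => ?_) fun x hx =>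
      antiInvariant_div_eq H (Metric.ne_of_mem_sphere hx one_ne_zero))
    have hx1 : ‖x‖ = 1 := by simpa using hx
    have h1 : x - u / q ≠ 0 := sub_ne_zero.2 fun h => by
      rw [h, norm_div, Complex.norm_real, Real.norm_of_nonneg H.hq0.le, div_eq_one_iff_eq
        H.hq0.ne'] at hx1
      exact H.hu0.ne' hx1
    have h2 : x - 1 / u ≠ 0 := sub_ne_zero.2 fun h => by
      rw [h, norm_div, norm_one, one_div, inv_eq_one] at hx1
      exact H.hu1.ne hx1
    have hd := annulusPart_differentiableAt H hx1.ge
      (hx1.le.trans ((one_lt_inv₀ H.hq0).2 H.hq1).le)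
    have hden : ContinuousAt (fun x => (x - u / q) * (x - 1 / u)) x := by fun_prop
    exact (hd.continuousAt.div hden (mul_ne_zero h1 h2)).continuousWithinAt
  have i1' : CircleIntegrable (fun x =>
      (1 - a * b) * (1 - a * c) * macdonaldMehtaIntegrand q a b c u x) 0 1 :=
    ((continuousOn_integrand H).const_mul _).circleIntegrable zero_le_one
  have i2' : CircleIntegrable (fun x =>
      b * c * macdonaldMehtaIntegrand q (a * q) b c u x) 0 1 :=
    ((continuousOn_integrand H').const_mul _).circleIntegrable zero_le_one
  have i12 : CircleIntegrable (fun x =>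
      (1 - a * b) * (1 - a * c) * macdonaldMehtaIntegrand q a b c u x -
        b * c * macdonaldMehtaIntegrand q (a * q) b c u x) 0 1 := i1'.sub i2'
  have hsub : (∮ x in C(0, 1), antiInvariant q a b c u (1 / x) / x) =
      ∮ x in C(0, 1), ((1 - a * b) * (1 - a * c) * macdonaldMehtaIntegrand q a b c u x -
        b * c * macdonaldMehtaIntegrand q (a * q) b c u x) - antiInvariant q a b c u x / x := by
    refine circleIntegral.integral_congr zero_le_one fun x hx => ?_
    have := integrand_eq_antiInvariant_add H (x := x) (by simpa using hx)
    linear_combination -this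
  rw [circleIntegral.integral_sub i12 i3, circleIntegral.integral_sub i1' i2',
    circleIntegral.integral_const_mul, circleIntegral.integral_const_mul, hinv] at hsub
  have h := circleIntegral_antiInvariant H
  linear_combination -hsub + 2 * h

end

/-! ### The series of residues -/

section

variable {q : ℝ} {a b c u : ℂ}

lemma residueConst_ne_zero (H : IsGeneric q a b c u) : residueConst q b c u ≠ 0 :=
  mul_ne_zero (mul_ne_zero (pow_ne_zero 2
    (qPoch_ne_zero_of_norm_lt_one H.hq0 H.hq1 (norm_ofReal_lt_one H.hq0 H.hq1)))
    (qTheta_ne_zero H.hq0 H.hq1 (mul_ne_zero H.hb0 H.u_ne_zero) H.hbu))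
    (qTheta_ne_zero H.hq0 H.hq1 (mul_ne_zero H.hc0 H.u_ne_zero) H.hcu)

lemma one_sub_ne_zero_of_norm {x : ℂ} (hx : ‖x‖ < 1) : 1 - x ≠ 0 := sub_ne_zero.2 fun h => by
  rw [← h, norm_one] at hx
  exact lt_irrefl _ hx

/-- The residues of the `q`-difference telescope. -/
lemma residueValue_recurrence (H : IsGeneric q a b c u) (k : ℕ) :
    (1 - a * b) * (1 - a * c) * residueValue q a b c u (k + 1) -
        b * c * residueValue q (a * q) b c u (k + 1) =
      telescopingTerm q a b c u (k + 1) - telescopingTerm q a b c u k := by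
  have hqc := H.q_ne_zero
  have hu := H.u_ne_zero
  have hκ := residueConst_ne_zero H
  have hy1 := norm_inv_pole_lt_one H (Nat.succ_pos k)
  have hbc := mul_ne_zero H.hb0 H.hc0
  obtain ⟨y, hy⟩ : ∃ y, y = (q : ℂ) ^ (k + 1) / u := ⟨_, rfl⟩
  rw [Nat.succ_eq_add_one, ← hy] at hy1
  have hy0 : y ≠ 0 := hy ▸ div_ne_zero (pow_ne_zero _ hqc) hu
  have e0 : a * q * u * (q : ℂ) ^ (-((k + 1 : ℕ) : ℤ)) = a * u * (q : ℂ) ^ (-(k : ℤ)) := by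
    rw [Nat.cast_succ, neg_add, zpow_add₀ hqc, zpow_neg_one]
    field_simp
  have e1 : a * u * (q : ℂ) ^ (-((k + 1 : ℕ) : ℤ)) = a / y := by
    rw [hy, zpow_neg, zpow_natCast]
    field_simp
  have e2 : a / y * q = a * u * (q : ℂ) ^ (-(k : ℤ)) := by rw [← e0, ← e1]; ring
  have e3 : ∀ s : ℂ, q * ((q : ℂ) ^ k / u) / s = y / s := fun s => by rw [hy, pow_succ']; ring
  have e4 : ∀ s : ℂ, s * q * ((q : ℂ) ^ k / u) = s * y := fun s => by rw [hy, pow_succ']; ring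
  have e5 : (b * c) ^ (-(k : ℤ)) = b * c * (b * c) ^ (-((k + 1 : ℕ) : ℤ)) := by
    rw [Nat.cast_succ, neg_add, zpow_add₀ hbc, zpow_neg_one]
    linear_combination (-(b * c) ^ (-(k : ℤ))) * mul_inv_cancel₀ hbc
  have e6 : ∀ s : ℂ, s * y * q = s * q * y := fun s => by ring
  have e7 : ∀ s : ℂ, y / s * q = q * y / s := fun s => by ring
  have hS := fun s : ℂ => qPoch_eq_mul H.hq0 H.hq1 (s * y)
  simp only [e6] at hS
  have hD := fun s : ℂ => qPoch_eq_mul H.hq0 H.hq1 (y / s)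
  simp only [e7] at hD
  have hA := qPoch_eq_mul H.hq0 H.hq1 (a / y)
  rw [e2] at hA
  have hA0 : qPoch q (a / y) ≠ 0 := by
    rw [← e1]
    exact qPoch_ne_zero_of_zpow H.hq0 H.hq1 (mul_zpow_neg_ne H H.hau _)
  -- the polynomial identity left after removing the common infinite products
  have hpoly : (1 - y ^ 2) * ((1 - a * b) * (1 - a * c) -
      b * c * ((1 - a / y) * (1 - a * y))) = (1 - a * y) * (1 - b * y) * (1 - c * y) -
      b * c * ((1 - a / y) * ((1 - y / b) * (1 - y / c))) := by
    have := H.hb0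
    have := H.hc0
    field_simp
    ring
  have hs1 := qPoch_ne_zero_of_norm_lt_one H.hq0 H.hq1 (norm_mul_lt_one H.ha1 hy1)
  have hs2 := qPoch_ne_zero_of_norm_lt_one H.hq0 H.hq1 (norm_mul_lt_one H.hb1 hy1)
  have hs3 := qPoch_ne_zero_of_norm_lt_one H.hq0 H.hq1 (norm_mul_lt_one H.hc1 hy1)
  rw [residueValue, residueValue, telescopingTerm, telescopingTerm, residueFactor, residueFactor,
    e0, e5, ← hy, e1]
  simp only [e3, e4]
  rw [hS a, hS b, hS c, hD b, hD c]
  rw [hA] at hA0 ⊢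
  rw [hS] at hs1 hs2 hs3
  clear e0 e1 e2 e3 e4 e5 e6 e7 hS hD hA
  generalize (b * c) ^ (-((k + 1 : ℕ) : ℤ)) = Z at *
  generalize residueConst q b c u = κ at *
  generalize qPoch q (a * u * (q : ℂ) ^ (-(k : ℤ))) = A at *
  generalize qPoch q (a * q * y) = A' at *
  generalize qPoch q (b * q * y) = B' at *
  generalize qPoch q (c * q * y) = C' at *
  generalize qPoch q (q * y / b) = B at *
  generalize qPoch q (q * y / c) = C at *
  obtain ⟨ht, hA⟩ := mul_ne_zero_iff.1 hA0
  obtain ⟨h1, hA'⟩ := mul_ne_zero_iff.1 hs1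
  obtain ⟨h2, hB'⟩ := mul_ne_zero_iff.1 hs2
  obtain ⟨h3, hC'⟩ := mul_ne_zero_iff.1 hs3
  generalize 1 - a / y = t at *
  generalize 1 - a * y = s₁ at *
  generalize 1 - b * y = s₂ at *
  generalize 1 - c * y = s₃ at *
  generalize 1 - y / b = t₂ at *
  generalize 1 - y / c = t₃ at *
  generalize 1 - y ^ 2 = v at *
  field_simp
  linear_combination Z * B * C * hpoly

lemma exists_residueFactor_le (hq0 : 0 < q) (hq1 : q < 1) (hb1 : ‖b‖ < 1) (hc1 : ‖c‖ < 1)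
    {r : ℝ} (hr : r < 1) :
    ∃ C : ℝ, 0 < C ∧ ∀ s y : ℂ, ‖s‖ < 1 → ‖y‖ ≤ r → ‖residueFactor q s b c y‖ ≤ C := by
  obtain ⟨C₁, h1, hC₁⟩ := exists_norm_qPoch_le hq0 hq1 (q * 1 / ‖b‖)
  obtain ⟨C₂, h2, hC₂⟩ := exists_norm_qPoch_le hq0 hq1 (q * 1 / ‖c‖)
  obtain ⟨C₃, h3, hC₃⟩ := exists_norm_inv_qPoch_le hq0 hq1 hr
  refine ⟨2 * C₁ * C₂ * (C₃ * C₃ * C₃), by positivity, fun s y hs hy => ?_⟩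
  have hy1 : ‖y‖ ≤ 1 := hy.trans hr.le
  have hden : ∀ t : ℂ, ‖t‖ < 1 → ‖(qPoch q (t * y))⁻¹‖ ≤ C₃ := fun t ht => by
    refine hC₃ _ (le_trans ?_ hy)
    rw [norm_mul]
    exact mul_le_of_le_one_left (norm_nonneg _) ht.le
  have hnum : ∀ t : ℂ, ‖(q : ℂ) * y / t‖ ≤ q * 1 / ‖t‖ := fun t => by
    rw [norm_div, norm_mul, Complex.norm_real, Real.norm_of_nonneg hq0.le]
    gcongr
  have hsq : ‖1 - y ^ 2‖ ≤ 2 := by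
    refine (norm_sub_le _ _).trans ?_
    rw [norm_one, norm_pow]
    linarith [pow_le_one₀ (n := 2) (norm_nonneg y) hy1]
  rw [residueFactor, div_eq_mul_inv, mul_inv, mul_inv, norm_mul, norm_mul, norm_mul, norm_mul,
    norm_mul]
  exact mul_le_mul (mul_le_mul (mul_le_mul hsq (hC₁ _ (hnum b)) (norm_nonneg _) two_pos.le)
    (hC₂ _ (hnum c)) (norm_nonneg _) (by positivity))
    (mul_le_mul (mul_le_mul (hden s hs) (hden b hb1) (norm_nonneg _) h3.le) (hden c hc1)
    (norm_nonneg _) (by positivity)) (by positivity) (by positivity)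

lemma tendsto_residueFactor (hq0 : 0 < q) (hq1 : q < 1) {s y : ℕ → ℂ}
    (hs : ∀ n, ‖s n‖ ≤ 1) (hy : Tendsto y atTop (𝓝 0)) :
    Tendsto (fun n => residueFactor q (s n) b c (y n)) atTop (𝓝 1) := by
  have hP : ∀ x : ℕ → ℂ, Tendsto x atTop (𝓝 0) →
      Tendsto (fun n => qPoch q (x n)) atTop (𝓝 1) := fun x hx => by
    have := ((continuous_qPoch hq0 hq1).tendsto 0).comp hx
    rwa [qPoch_zero] at this
  have hsy : Tendsto (fun n => s n * y n) atTop (𝓝 0) := by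
    refine squeeze_zero_norm (fun n => ?_) (by simpa using hy.norm)
    rw [norm_mul]
    exact mul_le_of_le_one_left (norm_nonneg _) (hs n)
  have h1 : Tendsto (fun n => 1 - y n ^ 2) atTop (𝓝 1) := by simpa using (hy.pow 2).const_sub 1
  have hb := hP (fun n => q * y n / b) (by simpa using (hy.const_mul (q : ℂ)).div_const b)
  have hc := hP (fun n => q * y n / c) (by simpa using (hy.const_mul (q : ℂ)).div_const c)
  have hb' := hP (fun n => b * y n) (by simpa using hy.const_mul b)
  have hc' := hP (fun n => c * y n) (by simpa using hy.const_mul c)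
  simpa [residueFactor] using! ((h1.mul hb).mul hc).div (((hP _ hsy).mul hb').mul hc') (by simp)

lemma norm_bc_lt_one (H : IsGeneric q a b c u) : ‖b * c‖ < 1 := norm_mul_lt_one H.hb1 H.hc1

lemma hasSum_bilateral (H : IsGeneric q a b c u) :
    HasSum (fun m : ℤ => (b * c) ^ m / qPoch q (a * u * (q : ℂ) ^ m))
      (qPoch q q * qTheta q (a * u * (b * c)) / (qTheta q (a * u) * qPoch q (b * c))) :=
  hasSum_zpow_div_qPoch H.hq0 H.hq1 (mul_ne_zero H.ha0 H.u_ne_zero) H.hau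
    (mul_ne_zero H.hb0 H.hc0) (norm_bc_lt_one H)
    (norm_mul_lt_one (norm_mul_lt_one H.ha1 H.hu1) (norm_bc_lt_one H))

lemma norm_inv_pole_le (H : IsGeneric q a b c u) {k : ℕ} (hk : 1 ≤ k) :
    ‖(q : ℂ) ^ k / u‖ ≤ q / ‖u‖ := by
  have hu := H.hq0.trans H.hu0
  rw [norm_div, norm_pow, Complex.norm_real, Real.norm_of_nonneg H.hq0.le]
  gcongr
  exact pow_le_of_le_one H.hq0.le H.hq1.le (by omega)

lemma summable_residueValue (H : IsGeneric q a b c u) :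
    Summable fun k : ℕ => residueValue q a b c u (k + 1) := by
  obtain ⟨C, -, hC⟩ := exists_residueFactor_le H.hq0 H.hq1 H.hb1 H.hc1
    ((div_lt_one (H.hq0.trans H.hu0)).2 H.hu0)
  have hinj : Function.Injective (fun k : ℕ => -((k + 1 : ℕ) : ℤ)) := fun i j h => by
    simpa using h
  have hs := ((hasSum_bilateral H).summable.norm.comp_injective hinj).mul_right
    (C / ‖residueConst q b c u‖)
  refine Summable.of_norm_bounded hs fun k => ?_
  rw [residueValue, norm_div, norm_mul, Function.comp, mul_div_assoc]
  gcongr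
  exact hC _ _ H.ha1 (norm_inv_pole_le H (Nat.succ_pos k))

lemma tendsto_inv_pole (H : IsGeneric q a b c u) :
    Tendsto (fun k : ℕ => (q : ℂ) ^ (k + 1) / u) atTop (𝓝 0) := by
  simpa using ((tendsto_ofReal_pow H.hq0 H.hq1).comp (tendsto_add_atTop_nat 1)).div_const u

lemma tendsto_telescopingTerm (H : IsGeneric q a b c u) :
    Tendsto (fun k : ℕ => telescopingTerm q a b c u (k + 1)) atTop (𝓝 0) := by
  have hy := tendsto_inv_pole H
  have hm : Tendsto (fun k : ℕ => (1 - a * ((q : ℂ) ^ (k + 1) / u)) *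
      (1 - b * ((q : ℂ) ^ (k + 1) / u)) * (1 - c * ((q : ℂ) ^ (k + 1) / u)) /
      (1 - ((q : ℂ) ^ (k + 1) / u) ^ 2)) atTop (𝓝 1) := by
    have h : ∀ s : ℂ, Tendsto (fun k : ℕ => 1 - s * ((q : ℂ) ^ (k + 1) / u)) atTop (𝓝 1) :=
      fun s => by simpa using (hy.const_mul s).const_sub 1
    have h2 : Tendsto (fun k : ℕ => 1 - ((q : ℂ) ^ (k + 1) / u) ^ 2) atTop (𝓝 1) := by
      simpa using (hy.pow 2).const_sub 1
    simpa using! (((h a).mul (h b)).mul (h c)).div h2 one_ne_zero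
  have h := (summable_residueValue H).tendsto_atTop_zero.mul hm
  rw [zero_mul] at h
  refine h.congr fun k => ?_
  have hy1 := norm_inv_pole_lt_one H (Nat.succ_pos k)
  rw [Nat.succ_eq_add_one] at hy1
  rw [residueValue, telescopingTerm, residueFactor]
  generalize (q : ℂ) ^ (k + 1) / u = y at *
  have e : ∀ s : ℂ, s * y * q = s * q * y := fun s => by ring
  have hv : 1 - y ^ 2 ≠ 0 := one_sub_ne_zero_of_norm (by
    rw [norm_pow]; exact pow_lt_one₀ (norm_nonneg _) hy1 two_ne_zero)
  have h1 := one_sub_ne_zero_of_norm (norm_mul_lt_one H.ha1 hy1)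
  have h2 := one_sub_ne_zero_of_norm (norm_mul_lt_one H.hb1 hy1)
  have h3 := one_sub_ne_zero_of_norm (norm_mul_lt_one H.hc1 hy1)
  rw [qPoch_eq_mul H.hq0 H.hq1 (a * y), qPoch_eq_mul H.hq0 H.hq1 (b * y),
    qPoch_eq_mul H.hq0 H.hq1 (c * y), e, e, e]
  generalize 1 - a * y = s₁ at *
  generalize 1 - b * y = s₂ at *
  generalize 1 - c * y = s₃ at *
  generalize 1 - y ^ 2 = v at *
  generalize residueConst q b c u = κ
  generalize (b * c) ^ (-((k + 1 : ℕ) : ℤ)) / _ = Z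
  field_simp

/-! ### The recurrence in `a` and its limit -/

/-- The integral together with the series of the (closed forms of the) residues. -/
noncomputable def integralPlusResidues (q : ℝ) (a b c u : ℂ) : ℂ :=
  1 / (4 * (Real.pi : ℂ) * Complex.I) * (∮ x in C(0, 1), macdonaldMehtaIntegrand q a b c u x) +
    ∑' k : ℕ, residueValue q a b c u (k + 1)

lemma integralPlusResidues_recurrence (H : IsGeneric q a b c u) :
    (1 - a * b) * (1 - a * c) * integralPlusResidues q a b c u =
      b * c * integralPlusResidues q (a * q) b c u := by
  have H' : IsGeneric q (a * q) b c u := by simpa using H.mul_q_pow 1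
  have hI := circleIntegral_recurrence H
  have s1 := (summable_residueValue H).mul_left ((1 - a * b) * (1 - a * c))
  have s2 := (summable_residueValue H').mul_left (b * c)
  have hsum : (1 - a * b) * (1 - a * c) * (∑' k : ℕ, residueValue q a b c u (k + 1)) -
      b * c * (∑' k : ℕ, residueValue q (a * q) b c u (k + 1)) =
      -telescopingTerm q a b c u 0 := by
    rw [← tsum_mul_left, ← tsum_mul_left, ← s1.tsum_sub s2]
    refine tendsto_nhds_unique (s1.sub s2).hasSum.tendsto_sum_nat ?_
    simp only [residueValue_recurrence H]
    simp only [Finset.sum_range_sub]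
    simpa using ((tendsto_add_atTop_iff_nat 1).1 (tendsto_telescopingTerm H)).sub_const
      (telescopingTerm q a b c u 0)
  have hpi : (Real.pi : ℂ) ≠ 0 := by exact_mod_cast Real.pi_ne_zero
  have hI' : 1 / (4 * (Real.pi : ℂ) * Complex.I) * (4 * Real.pi * Complex.I *
      telescopingTerm q a b c u 0) = telescopingTerm q a b c u 0 := by
    have := Complex.I_ne_zero
    field_simp
  unfold integralPlusResidues
  linear_combination (1 / (4 * (Real.pi : ℂ) * Complex.I)) * hI + hI' + hsum

lemma integralPlusResidues_iterate (H : IsGeneric q a b c u) (n : ℕ) :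
    (∏ i ∈ Finset.range n, (1 - a * b * (q : ℂ) ^ i)) *
        (∏ i ∈ Finset.range n, (1 - a * c * (q : ℂ) ^ i)) * integralPlusResidues q a b c u =
      (b * c) ^ n * integralPlusResidues q (a * (q : ℂ) ^ n) b c u := by
  induction n with
  | zero => simp
  | succ n ih =>
    have h := integralPlusResidues_recurrence (H.mul_q_pow n)
    rw [Finset.prod_range_succ, Finset.prod_range_succ, pow_succ, pow_succ, ← mul_assoc a]
    linear_combination (1 - a * b * (q : ℂ) ^ n) * (1 - a * c * (q : ℂ) ^ n) * ih +
      (b * c) ^ n * h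

lemma tendsto_circleIntegral (H : IsGeneric q a b c u) :
    Tendsto (fun n : ℕ => (b * c) ^ n *
      ∮ x in C(0, 1), macdonaldMehtaIntegrand q (a * (q : ℂ) ^ n) b c u x) atTop (𝓝 0) := by
  obtain ⟨M, hM⟩ := (isCompact_sphere (0 : ℂ) 1).exists_bound_of_continuousOn
    (continuousOn_integrand H)
  obtain ⟨C₁, h1, hC₁⟩ := exists_norm_qPoch_le H.hq0 H.hq1 1
  obtain ⟨C₂, h2, hC₂⟩ := exists_norm_inv_qPoch_le H.hq0 H.hq1 H.ha1
  have hq' : ∀ n : ℕ, ‖a * (q : ℂ) ^ n‖ ≤ ‖a‖ := fun n => by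
    rw [norm_mul, norm_pow]
    exact mul_le_of_le_one_right (norm_nonneg _)
      (pow_le_one₀ (norm_nonneg _) (norm_ofReal_lt_one H.hq0 H.hq1).le)
  have hbound : ∀ (n : ℕ) (x : ℂ), x ∈ Metric.sphere (0 : ℂ) 1 →
      ‖macdonaldMehtaIntegrand q (a * (q : ℂ) ^ n) b c u x‖ ≤ C₁ * C₁ * (C₂ * C₂) * M := by
    intro n x hx
    have hx1 : ‖x‖ = 1 := by simpa using hx
    have hden := integrand_den_ne_zero H hx1
    simp only [ne_eq, mul_eq_zero, not_or] at hden
    have e : macdonaldMehtaIntegrand q (a * (q : ℂ) ^ n) b c u x =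
        qPoch q (a * x) * qPoch q (a / x) * ((qPoch q (a * (q : ℂ) ^ n * x))⁻¹ *
          (qPoch q (a * (q : ℂ) ^ n / x))⁻¹) * macdonaldMehtaIntegrand q a b c u x := by
      rw [macdonaldMehtaIntegrand_eq, macdonaldMehtaIntegrand_eq]
      obtain ⟨⟨⟨⟨⟨h1, h2⟩, -⟩, -⟩, -⟩, -⟩ := hden
      generalize qPoch q (a * x) = A at *
      generalize qPoch q (a / x) = A' at *
      simp only [div_eq_mul_inv, mul_inv]
      field_simp
    rw [e, norm_mul, norm_mul, norm_mul, norm_mul]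
    refine mul_le_mul (mul_le_mul (mul_le_mul (hC₁ _ ?_) (hC₁ _ ?_) (norm_nonneg _) h1.le)
      (mul_le_mul (hC₂ _ ?_) (hC₂ _ ?_) (norm_nonneg _) h2.le) (by positivity) (by positivity))
      (hM x hx) (norm_nonneg _) (by positivity)
    · rw [norm_mul, hx1, mul_one]; exact H.ha1.le
    · rw [norm_div, hx1, div_one]; exact H.ha1.le
    · rw [norm_mul, hx1, mul_one]; exact hq' n
    · rw [norm_div, hx1, div_one]; exact hq' n
  refine squeeze_zero_norm (a := fun n => ‖b * c‖ ^ n * (2 * Real.pi * 1 *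
    (C₁ * C₁ * (C₂ * C₂) * M))) (fun n => ?_) ?_
  · rw [norm_mul, norm_pow]
    exact mul_le_mul_of_nonneg_left (circleIntegral.norm_integral_le_of_norm_le_const zero_le_one
      (hbound n)) (by positivity)
  · simpa using (tendsto_pow_atTop_nhds_zero_of_lt_one (norm_nonneg _)
      (norm_bc_lt_one H)).mul_const _

/-- The rescaled residues at `a q ^ n`, reindexed by `m = n - k`, form a series over `m < n` that
converges to the bilateral series. -/
lemma tendsto_tsum_residueValue (H : IsGeneric q a b c u) :
    Tendsto (fun n : ℕ => (b * c) ^ n *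
      ∑' k : ℕ, residueValue q (a * (q : ℂ) ^ n) b c u (k + 1)) atTop
      (𝓝 (qPoch q q * qTheta q (a * u * (b * c)) / (qTheta q (a * u) * qPoch q (b * c)) /
        residueConst q b c u)) := by
  have hqc := H.q_ne_zero
  have hbc := mul_ne_zero H.hb0 H.hc0
  obtain ⟨C, hC0, hC⟩ := exists_residueFactor_le H.hq0 H.hq1 H.hb1 H.hc1
    ((div_lt_one (H.hq0.trans H.hu0)).2 H.hu0)
  set G : ℤ → ℂ := fun m => (b * c) ^ m / qPoch q (a * u * (q : ℂ) ^ m) with hG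
  set f : ℕ → ℤ → ℂ := fun n m => if m < n then
    G m * residueFactor q (a * (q : ℂ) ^ n) b c ((q : ℂ) ^ ((n : ℤ) - m) / u) /
      residueConst q b c u else 0 with hf
  have hsum : ∀ n : ℕ, ∑' m, f n m = (b * c) ^ n *
      ∑' k : ℕ, residueValue q (a * (q : ℂ) ^ n) b c u (k + 1) := by
    intro n
    have hinj : Function.Injective (fun k : ℕ => (n : ℤ) - (k + 1 : ℕ)) := fun i j h => by
      simpa using h
    rw [← tsum_mul_left, ← hinj.tsum_eq]
    · refine tsum_congr fun k => ?_
      have hlt : (n : ℤ) - (k + 1 : ℕ) < n := by omega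
      have e1 : a * u * (q : ℂ) ^ ((n : ℤ) - (k + 1 : ℕ)) =
          a * (q : ℂ) ^ n * u * (q : ℂ) ^ (-((k + 1 : ℕ) : ℤ)) := by
        rw [sub_eq_add_neg, zpow_add₀ hqc, zpow_natCast]; ring
      have e2 : (b * c) ^ ((n : ℤ) - (k + 1 : ℕ)) =
          (b * c) ^ n * (b * c) ^ (-((k + 1 : ℕ) : ℤ)) := by
        rw [sub_eq_add_neg, zpow_add₀ hbc, zpow_natCast]
      simp only [hf, if_pos hlt, hG, e1, e2, residueValue, sub_sub_cancel, zpow_natCast]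
      ring
    · intro m hm
      have hlt : m < n := by
        by_contra hcon
        exact hm (if_neg hcon)
      exact ⟨(n - 1 - m).toNat, by simp only; omega⟩
  have hq' : ∀ n : ℕ, ‖a * (q : ℂ) ^ n‖ < 1 := fun n => (H.mul_q_pow n).ha1
  have hlim := tendsto_tsum_of_dominated_convergence (𝓕 := atTop) (f := f)
    (g := fun m => G m / residueConst q b c u)
    (bound := fun m => ‖G m‖ * (C / ‖residueConst q b c u‖))
    ((hasSum_bilateral H).summable.norm.mul_right _) (fun m => ?_) (.of_forall fun n m => ?_)
  · rw [tsum_div_const, (hasSum_bilateral H).tsum_eq] at hlim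
    exact hlim.congr hsum
  · have hy : Tendsto (fun n : ℕ => (q : ℂ) ^ ((n : ℤ) - m) / u) atTop (𝓝 0) := by
      have := ((tendsto_ofReal_pow H.hq0 H.hq1).mul_const ((q : ℂ) ^ (-m))).div_const u
      rw [zero_mul, zero_div] at this
      refine this.congr fun n => ?_
      rw [sub_eq_add_neg, zpow_add₀ hqc, zpow_natCast]
    have h := ((tendsto_residueFactor (b := b) (c := c) H.hq0 H.hq1 (fun n => (hq' n).le)
      hy).const_mul (G m)).div_const (residueConst q b c u)
    rw [mul_one] at h
    refine h.congr' ?_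
    filter_upwards [eventually_gt_atTop m.toNat] with n hn
    simp only [hf, if_pos (show m < n by omega)]
  · simp only [hf]
    split_ifs with hlt
    · obtain ⟨k, hk⟩ : ∃ k : ℕ, (n : ℤ) - m = (k : ℤ) := ⟨(n - m).toNat, by omega⟩
      rw [norm_div, norm_mul, mul_div_assoc, hk, zpow_natCast]
      gcongr
      exact hC _ _ (hq' n) (norm_inv_pole_le H (by omega))
    · rw [norm_zero]; positivity

lemma integralPlusResidues_eq (H : IsGeneric q a b c u) :
    integralPlusResidues q a b c u = 1 / qPochs q [(q : ℂ), a * b, a * c, b * c] *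
      (qTheta q (a * b * c * u) / qThetas q [a * u, b * u, c * u]) := by
  have h1 := ((tendsto_prod_qPoch H.hq0 H.hq1 (a * b)).mul
    (tendsto_prod_qPoch H.hq0 H.hq1 (a * c))).mul_const (integralPlusResidues q a b c u)
  have h2 := ((tendsto_circleIntegral H).const_mul (1 / (4 * (Real.pi : ℂ) * Complex.I))).add
    (tendsto_tsum_residueValue H)
  rw [mul_zero, zero_add] at h2
  have h3 := tendsto_nhds_unique (h1.congr (integralPlusResidues_iterate H)) (h2.congr fun n => by
    rw [integralPlusResidues]; ring)
  have hab := qPoch_ne_zero_of_norm_lt_one H.hq0 H.hq1 (norm_mul_lt_one H.ha1 H.hb1)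
  have hac := qPoch_ne_zero_of_norm_lt_one H.hq0 H.hq1 (norm_mul_lt_one H.ha1 H.hc1)
  have hqq := qPoch_ne_zero_of_norm_lt_one H.hq0 H.hq1 (norm_ofReal_lt_one H.hq0 H.hq1)
  have e : a * u * (b * c) = a * b * c * u := by ring
  rw [e, residueConst] at h3
  simp only [qPochs, qThetas, List.map_cons, List.map_nil, List.prod_cons, List.prod_nil, mul_one]
  generalize qPoch q (a * b) = A at *
  generalize qPoch q (a * c) = B at *
  generalize qPoch q (b * c) = C at *
  generalize qPoch q (q : ℂ) = P at *
  have hJ : integralPlusResidues q a b c u = (A * B)⁻¹ * (A * B * integralPlusResidues q a b c u) :=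
    (inv_mul_cancel_left₀ (mul_ne_zero hab hac) _).symm
  rw [hJ, h3]
  simp only [div_eq_mul_inv, mul_inv, pow_two]
  field_simp

end

/-! ### The evaluation -/

theorem theorem5p4 (q : ℝ) (hq0 : 0 < q) (hq1 : q < 1)
    (a b c u : ℂ) (ha0 : a ≠ 0) (hb0 : b ≠ 0) (hc0 : c ≠ 0)
    (ha1 : ‖a‖ < 1) (hb1 : ‖b‖ < 1) (hc1 : ‖c‖ < 1)
    (hu0 : q < ‖u‖) (hu1 : ‖u‖ < 1)
    -- genericity: no zero in the denominator on the right, only simple poles on the left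
    (hau : ∀ n : ℤ, a * u ≠ (q : ℂ) ^ n)
    (hbu : ∀ n : ℤ, b * u ≠ (q : ℂ) ^ n)
    (hcu : ∀ n : ℤ, c * u ≠ (q : ℂ) ^ n)
    (huu : ∀ n : ℤ, u ^ 2 ≠ (q : ℂ) ^ n) :
    -- the integral, the residues and the series of residues are well defined
    CircleIntegrable (macdonaldMehtaIntegrand q a b c u) 0 1 ∧
    (∀ k : ℕ, 1 ≤ k →
      MeromorphicAt (macdonaldMehtaIntegrand q a b c u) (u * (q : ℂ) ^ (-(k : ℤ)))) ∧
    Summable (fun k : ℕ =>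
      complexResidue (macdonaldMehtaIntegrand q a b c u) (u * (q : ℂ) ^ (-((k : ℤ) + 1)))) ∧
    -- the evaluation (the summation index of the series is `k + 1 ≥ 1`)
    1 / (4 * (Real.pi : ℂ) * Complex.I) *
        (∮ x in C(0, 1), macdonaldMehtaIntegrand q a b c u x) +
      ∑' k : ℕ,
        complexResidue (macdonaldMehtaIntegrand q a b c u) (u * (q : ℂ) ^ (-((k : ℤ) + 1))) =
      1 / qPochs q [(q : ℂ), a * b, a * c, b * c] *
        (qTheta q (a * b * c * u) / qThetas q [a * u, b * u, c * u]) := by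
  have H : IsGeneric q a b c u :=
    ⟨hq0, hq1, ha0, hb0, hc0, ha1, hb1, hc1, hu0, hu1, hau, hbu, hcu, huu⟩
  have hres : ∀ k : ℕ, complexResidue (macdonaldMehtaIntegrand q a b c u)
      (u * (q : ℂ) ^ (-((k : ℤ) + 1))) = residueValue q a b c u (k + 1) := fun k =>
    (complexResidue_integrand H (Nat.succ_pos k)).1
  refine ⟨circleIntegrable_integrand H, fun k hk => (complexResidue_integrand H hk).2, ?_, ?_⟩
  · simpa only [hres] using summable_residueValue H
  · simp only [hres]
    exact integralPlusResidues_eq H
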